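/- **Setting.** Consider a Markov decision process with a measurable state space $\mathcal S$ (singletons measurable) carrying a $\sigma$-finite reference measure $\mathrm ds$ (for instance a Borel set $\mathcal S\subseteq\mathbb R^{n_s}$ with Lebesgue measure), actions $\mathcal A\subseteq\mathbb R^{n_a}$, a measurable reward $R(s,a)$ that is bounded on $\mathcal S\times\mathcal A$, jointly measurable transition probability densities $\rho(s^+\mid s,a)$ such that $a\mapsto\rho(s^+\mid s,a)$ is continuous on the interior of $\mathcal A$ for all $s,s^+$, an initial distribution $\rho_0$, and a discount factor $0<\gamma<1$. A policy is a measurable map $\pi:\mathcal S\to\mathcal A$. Put $$V^\pi(s)=\sum_{n\ge0}\gamma^n\,\mathbb E\big[R(s_n,\pi(s_n))\,\big|\,s_0=s,\ s_{i+1}\sim\rho(\cdot\mid s_i,\pi(s_i))\big],$$ $$Q^\pi(s,a)=R(s,a)+\gamma\int\rho(s^+\mid s,a)\,V^\pi(s^+)\,\mathrm ds^+,\qquad J(\pi)=\mathbb E_{s_0\sim\rho_0}[V^\pi(s_0)].$$ A policy $\pi^\star$ is optimal if $V^{\pi^\star}(s)\ge V^\pi(s)$ for all policies $\pi$ and all $s\in\mathcal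 S$. Let $(\pi_\theta)_{\theta\in\mathbb R^{n_\theta}}$ be a family of policies, and $J(\theta)=J(\pi_\theta)$. Write $\mathbb E_s[f(s)]=\sum_{n\ge0}\gamma^n\,\mathbb E[f(s_n)]$, with $s_0\sim\rho_0$ and $s_{i+1}\sim\rho(\cdot\mid s_i,\pi_\theta(s_i))$, for the integral over the (unnormalized) discounted distribution of the states in closed loop with $\pi_\theta$, and define the $n_\theta\times n_\theta$ matrices $$M_1(\theta)=\mathbb E_s\big[\nabla_\theta^2\pi_\theta(s)\otimes\nabla_aQ^{\pi_\theta}(s,a)|_{a=\pi_\theta(s)}\big],$$ $$M_2(\theta)=\mathbb E_s\big[\nabla_\theta\pi_\theta(s)^\top\,\nabla_a^2Q^{\pi_\theta}(s,a)|_{a=\pi_\theta(s)}\,\nabla_\theta\pi_\theta(s)\big],$$ where $\nabla_\theta\pi_\theta(s)$ is the Jacobian, $\nabla^2_\theta\pi_\theta(s)$ is the tensor whose $i$-th slice is the Hessian of the $i$-th component of $\theta\mapsto\pi_\theta(s)$, and $T\otimes v=\sum_iT_{[i,:,:]}v_i$. "Twice differentiable at $x$" means differentiable near $x$ with a derivative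 that is differentiable at $x$. **Theorem.** Assume that the policy class contains an optimal policy: there are an optimal policy $\pi^\star$ and $\theta^\star\in\mathbb R^{n_\theta}$ with $\pi_{\theta^\star}=\pi^\star$. Let $U$ be a neighbourhood of $\theta^\star$ and $r>0$ such that 1. for all $s$, the map $\theta\mapsto\pi_\theta(s)$ is twice differentiable at every $\theta\in U$, and $\nabla_\theta\pi_\theta(s)$ and $\nabla^2_\theta\pi_\theta(s)$ are bounded over $\theta\in U$, $s\in\mathcal S$; 2. for all $s$, the ball $B_r(\pi^\star(s))$ is contained in $\mathcal A$, and for all $\theta\in U$ the function $Q^{\pi_\theta}(s,\cdot)$ is twice differentiable at every point of this ball; 3. $\nabla_aQ^{\pi_\theta}(s,a)|_{a=\pi_\theta(s)}$ is bounded over $\theta\in U$, $s\in\mathcal S$; and $\nabla^2_aQ^{\pi_\theta}(s,a)$ is bounded over $\theta\in U$, $s\in\mathcal S$, $a\in B_r(\pi^\star(s))$; 4. for all $s$, the map $(\theta,a)\mapsto\nabla_a^2Q^{\pi_\theta}(s,a)$ is continuous at $(\theta^\star,\pi^\star(s))$. Then $J$ is twice differentiable at $\theta^\star$, the integrands of $M_1(\theta)$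 and $M_2(\theta)$ are integrable for all $\theta$ near $\theta^\star$, and $$\lim_{\theta\to\theta^\star}M_1(\theta)=0,\qquad \lim_{\theta\to\theta^\star}M_2(\theta)=\nabla^2_\theta J(\theta^\star),\qquad M_2(\theta^\star)=\nabla^2_\theta J(\theta^\star).$$ -/

import Mathlib

open MeasureTheory Filter Topology Matrix

noncomputable section

/-- Real vectors with `n` coordinates and the Euclidean norm. -/
abbrev Vec (n : ℕ) : Type := EuclideanSpace ℝ (Fin n)

/-! ### Derivatives in coordinates -/

/-- The gradient `∇f(x)`: the vector of partial derivatives. -/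
def grad {n : ℕ} (f : Vec n → ℝ) (x : Vec n) : Fin n → ℝ :=
  fun i => fderiv ℝ f x (EuclideanSpace.single i 1)

/-- The Hessian `∇²f(x)`: the matrix of second partial derivatives. -/
def hess {n : ℕ} (f : Vec n → ℝ) (x : Vec n) : Matrix (Fin n) (Fin n) ℝ :=
  Matrix.of fun i j =>
    fderiv ℝ (fderiv ℝ f) x (EuclideanSpace.single i 1) (EuclideanSpace.single j 1)

/-- `f` is differentiable near `x` and its derivative is differentiable at `x`. -/
def TwiceDifferentiableAt {n : ℕ} (f : Vec n → ℝ) (x : Vec n) : Prop :=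
  (∀ᶠ y in 𝓝 x, DifferentiableAt ℝ f y) ∧ DifferentiableAt ℝ (fderiv ℝ f) x

/-- The Jacobian of a vector-valued map. -/
def jacobian {m n : ℕ} (g : Vec n → Vec m) (x : Vec n) : Matrix (Fin m) (Fin n) ℝ :=
  Matrix.of fun i j => grad (fun y => g y i) x j

/-- The second-order Jacobian tensor of a vector-valued map; its `i`-th slice is the Hessian of
the `i`-th component. -/
def jacobian₂ {m n : ℕ} (g : Vec n → Vec m) (x : Vec n) :
    Fin m → Matrix (Fin n) (Fin n) ℝ :=
  fun i => hess (fun y => g y i) x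

/-- The tensor-vector product `T ⊗ v = ∑ i, T[i,:,:] vᵢ`. -/
def tensorVec {m n k : ℕ} (T : Fin m → Matrix (Fin n) (Fin k) ℝ) (v : Fin m → ℝ) :
    Matrix (Fin n) (Fin k) ℝ :=
  ∑ i, v i • T i

/-! ### Markov decision processes -/

/-- A Markov decision process with states in `S` and actions in a subset of `ℝ^na`.
The transition probabilities have densities `trans s a` with respect to a reference measure
`base` on `S` (for a Borel set `S` in a Euclidean space: Lebesgue measure).
Values of `reward` and `trans` at actions outside `actions` carry no meaning. -/
structure MDP (S : Type*) [MeasurableSpace S] (na : ℕ) where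
  base : Measure S
  base_sigmaFinite : SigmaFinite base
  actions : Set (Vec na)
  reward : S → Vec na → ℝ
  measurable_reward : Measurable fun x : S × Vec na => reward x.1 x.2
  /-- `trans s a s'` is the density at `s'` of the successor of `s` under action `a`. -/
  trans : S → Vec na → S → ℝ
  measurable_trans : Measurable fun x : S × Vec na × S => trans x.1 x.2.1 x.2.2
  trans_nonneg : ∀ s, ∀ a ∈ actions, ∀ s', 0 ≤ trans s a s'
  trans_total : ∀ s, ∀ a ∈ actions, ∫⁻ s', ENNReal.ofReal (trans s a s') ∂base = 1
  /-- The distribution of the initial state. -/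
  init : Measure S
  init_prob : IsProbabilityMeasure init
  discount : ℝ
  discount_pos : 0 < discount
  discount_le_one : discount ≤ 1

namespace MDP

variable {S : Type*} [MeasurableSpace S] {na nθ : ℕ}

/-- A (deterministic) policy: a measurable map from states to admissible actions. -/
def IsPolicy (M : MDP S na) (pol : S → Vec na) : Prop :=
  Measurable pol ∧ ∀ s, pol s ∈ M.actions

/-- The distribution of the successor state of `s` in closed loop with the policy `pol`. -/
def nextDist (M : MDP S na) (pol : S → Vec na) (s : S) : Measure S :=
  M.base.withDensity fun s' => ENNReal.ofReal (M.trans s (pol s) s')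

/-- The distribution of the state `sₙ` in closed loop with the policy `pol`, if `s₀ ∼ μ`. -/
def stateDist (M : MDP S na) (pol : S → Vec na) (μ : Measure S) : ℕ → Measure S
  | 0 => μ
  | n + 1 => (stateDist M pol μ n).bind (M.nextDist pol)

/-- The state-value function: `V^π(s) = ∑ₙ γⁿ E[R(sₙ, π(sₙ)) | s₀ = s]`. -/
def V (M : MDP S na) (pol : S → Vec na) (s : S) : ℝ :=
  ∑' n : ℕ, M.discount ^ n *
    ∫ x, M.reward x (pol x) ∂(M.stateDist pol (Measure.dirac s) n)

/-- The action-value function: `Q^π(s,a) = R(s,a) + γ E[V^π(s⁺)]` with `s⁺ ∼ ρ(· | s, a)`. -/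
def Q (M : MDP S na) (pol : S → Vec na) (s : S) (a : Vec na) : ℝ :=
  M.reward s a + M.discount * ∫ s', M.trans s a s' * M.V pol s' ∂M.base

/-- The expected cumulative reward `J(π) = E[V^π(s₀)]`. -/
def J (M : MDP S na) (pol : S → Vec na) : ℝ :=
  ∫ s, M.V pol s ∂M.init

/-- A policy is optimal if no policy has a larger value in any state. -/
def IsOptimal (M : MDP S na) (pol : S → Vec na) : Prop :=
  M.IsPolicy pol ∧ ∀ pol', M.IsPolicy pol' → ∀ s, M.V pol' s ≤ M.V pol s

/-- The discounted distribution `∑ₙ γⁿ P(sₙ ∈ ·)` of the states that come up in closed loop with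
the policy `pol`. Like `J`, it is not normalized. -/
def occupancy (M : MDP S na) (pol : S → Vec na) : Measure S :=
  Measure.sum fun n : ℕ => ENNReal.ofReal (M.discount ^ n) • M.stateDist pol M.init n

/-- `∇²_θ π_θ(s) ⊗ ∇ₐ Q^{π_θ}(s, a)` at `a = π_θ(s)`. -/
def integrand₁ (M : MDP S na) (pol : Vec nθ → S → Vec na) (θ : Vec nθ) (s : S) :
    Matrix (Fin nθ) (Fin nθ) ℝ :=
  tensorVec (jacobian₂ (fun ϑ => pol ϑ s) θ) (grad (M.Q (pol θ) s) (pol θ s))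

/-- `∇_θ π_θ(s)ᵀ ∇²ₐ Q^{π_θ}(s, a) ∇_θ π_θ(s)` at `a = π_θ(s)`. -/
def integrand₂ (M : MDP S na) (pol : Vec nθ → S → Vec na) (θ : Vec nθ) (s : S) :
    Matrix (Fin nθ) (Fin nθ) ℝ :=
  (jacobian (fun ϑ => pol ϑ s) θ)ᵀ * hess (M.Q (pol θ) s) (pol θ s) *
    jacobian (fun ϑ => pol ϑ s) θ

/-- The matrix `M₁(θ)`; the expectation is taken entrywise. -/
def M₁ (M : MDP S na) (pol : Vec nθ → S → Vec na) (θ : Vec nθ) :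
    Matrix (Fin nθ) (Fin nθ) ℝ :=
  Matrix.of fun j k => ∫ s, M.integrand₁ pol θ s j k ∂(M.occupancy (pol θ))

/-- The Gauss-Newton matrix `M₂(θ)`; the expectation is taken entrywise. -/
def M₂ (M : MDP S na) (pol : Vec nθ → S → Vec na) (θ : Vec nθ) :
    Matrix (Fin nθ) (Fin nθ) ℝ :=
  Matrix.of fun j k => ∫ s, M.integrand₂ pol θ s j k ∂(M.occupancy (pol θ))

end MDP

end

noncomputable section

/-! ### Integration of bounded functions -/

/-! The performance difference lemma `MDP.integral_V_sub_integral_V` carries the proof: the gain of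
`π'` over `π` is the discounted sum, along the closed loop of `π'`, of the advantages `Q^π(s, π'(s))
- Q^π(s, π(s))`. It is used three times.

First, deviating from an optimal policy in one state shows that no single action has an advantage
(`MDP.IsOptimal.Q_le`), so `∇ₐQ` vanishes at `θ⋆` along the optimal policy. Second, freezing
`Q^{π_θ}` and letting only the action vary gives the policy gradient formula for `∇J(θ)` near `θ⋆`.
Third, at the critical parameter all advantages are second-order Taylor remainders, so `V^{π_θ} -
V^{π⋆}`, and with it `Q^{π_θ} - Q^{π⋆}` on the balls, is `O(‖θ - θ⋆‖²)` uniformly in the state.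

No derivative of `Q^{π_θ}` in `θ` is assumed. Instead, interpolation between a function and its
second derivative (`norm_fderiv_le_of_abs_le`) turns the quadratic estimate into one for gradients.
With bounded Hessians, `∇ₐQ^{π_θ}(s, π_θ(s))` is `O(‖θ - θ⋆‖)` uniformly in `s`, which gives `M₁ →
0`. With Hessians continuous at the limit point, the dependence of `Q` on `θ` contributes only `o(‖θ
- θ⋆‖)`, so the derivative of this gradient at `θ⋆` is `∇ₐ²Q ∘ ∇π`.

The integrand of the policy gradient thus vanishes at `θ⋆` and grows at most linearly. Hence the
change of the state distribution is invisible to first order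
(`MDP.exists_hasFDerivAt_discountedSum`), and differentiating the integrand alone gives `M₂(θ⋆) =
∇²J(θ⋆)`. Continuity of `M₂` at `θ⋆` follows from `MDP.tendsto_discountedSum`, which rests on
Scheffé's argument for the transition densities. -/

lemma integrable_of_abs_le {α : Type*} [MeasurableSpace α] {μ : Measure α} [IsFiniteMeasure μ]
    {f : α → ℝ} (hf : Measurable f) {C : ℝ} (hC : ∀ x, |f x| ≤ C) : Integrable f μ :=
  Integrable.of_bound hf.aestronglyMeasurable C (ae_of_all _ hC)

lemma abs_integral_le_of_abs_le {α : Type*} [MeasurableSpace α] {μ : Measure α}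
    [IsProbabilityMeasure μ] {f : α → ℝ} {C : ℝ} (hC : ∀ x, |f x| ≤ C) : |∫ x, f x ∂μ| ≤ C := by
  simpa using norm_integral_le_of_norm_le_const (μ := μ) (f := f) (ae_of_all _ hC)

lemma integral_bind_of_abs_le {α β : Type*} [MeasurableSpace α] [MeasurableSpace β]
    {μ : Measure α} [IsProbabilityMeasure μ] {m : α → Measure β} (hm : Measurable m)
    (hprob : ∀ x, IsProbabilityMeasure (m x)) {f : β → ℝ} (hf : Measurable f) {C : ℝ}
    (hC : ∀ x, |f x| ≤ C) : ∫ y, f y ∂(μ.bind m) = ∫ x, ∫ y, f y ∂(m x) ∂μ := by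
  let κ : ProbabilityTheory.Kernel α β := ⟨m, hm⟩
  have hκ : ProbabilityTheory.IsMarkovKernel κ := ⟨hprob⟩
  have hbind : IsProbabilityMeasure (μ.bind m) :=
    isProbabilityMeasure_bind hm.aemeasurable (ae_of_all _ hprob)
  have hint : Integrable f (μ.bind κ) := integrable_of_abs_le (μ := μ.bind m) hf hC
  change ∫ y, f y ∂(μ.bind κ) = ∫ x, ∫ y, f y ∂(κ x) ∂μ
  rw [Measure.comp_eq_comp_const_apply] at hint ⊢
  rw [ProbabilityTheory.Kernel.integral_comp hint]
  simp

lemma measurable_integral_of_measurable {α β : Type*} [MeasurableSpace α] [MeasurableSpace β]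
    {m : α → Measure β} (hm : Measurable m) (hprob : ∀ x, IsProbabilityMeasure (m x))
    {f : β → ℝ} (hf : Measurable f) : Measurable fun x => ∫ y, f y ∂(m x) := by
  let κ : ProbabilityTheory.Kernel α β := ⟨m, hm⟩
  have hκ : ProbabilityTheory.IsMarkovKernel κ := ⟨hprob⟩
  exact (StronglyMeasurable.integral_kernel (κ := κ) hf.stronglyMeasurable).measurable

/-- Bounded functions that converge pointwise, integrated against probability densities that
converge pointwise to a probability density. -/
lemma tendsto_integral_mul_density {α ι : Type*} [MeasurableSpace α] {μ : Measure α}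
    {l : Filter ι} [l.IsCountablyGenerated] {p : ι → α → ℝ} {p₀ : α → ℝ} {f : ι → α → ℝ}
    {f₀ : α → ℝ} {C : ℝ} (hp_nonneg : ∀ i x, 0 ≤ p i x)
    (hp_int : ∀ i, Integrable (p i) μ) (hp_one : ∀ i, ∫ x, p i x ∂μ = 1)
    (hp₀_nonneg : ∀ x, 0 ≤ p₀ x) (hp₀_int : Integrable p₀ μ) (hp₀_one : ∫ x, p₀ x ∂μ = 1)
    (hp_lim : ∀ x, Tendsto (fun i => p i x) l (𝓝 (p₀ x)))
    (hf : ∀ᶠ i in l, Measurable (f i)) (hC : ∀ᶠ i in l, ∀ x, |f i x| ≤ C)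
    (hf_lim : ∀ x, Tendsto (fun i => f i x) l (𝓝 (f₀ x))) :
    Tendsto (fun i => ∫ x, p i x * f i x ∂μ) l (𝓝 (∫ x, p₀ x * f₀ x ∂μ)) := by
  -- Scheffé's argument: the densities `p i` have no common majorant, but the positive part of `p₀ -
  -- p i` is dominated by `p₀`.
  have hdiff : Tendsto (fun i => ∫ x, max (p₀ x - p i x) 0 ∂μ) l (𝓝 0) := by
    have := tendsto_integral_filter_of_dominated_convergence (μ := μ) (l := l)
      (F := fun i x => max (p₀ x - p i x) 0) (f := fun _ => (0 : ℝ)) p₀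
      (Eventually.of_forall fun i => ((hp₀_int.sub (hp_int i)).pos_part).aestronglyMeasurable)
      (Eventually.of_forall fun i => ae_of_all _ fun x => by
        rw [Real.norm_of_nonneg (le_max_right _ _)]
        exact max_le (by linarith [hp_nonneg i x]) (hp₀_nonneg x)) hp₀_int
      (ae_of_all _ fun x => by
        have h := ((tendsto_const_nhds (x := p₀ x)).sub (hp_lim x)).max
          (tendsto_const_nhds (x := (0 : ℝ)))
        simpa using h)
    simpa using this
  have habs : Tendsto (fun i => ∫ x, |p i x - p₀ x| ∂μ) l (𝓝 0) := by
    -- Both densities have mass one, so the positive and negative parts of their difference have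
    -- equal integrals.
    have heq : ∀ i, ∫ x, |p i x - p₀ x| ∂μ = 2 * ∫ x, max (p₀ x - p i x) 0 ∂μ := by
      intro i
      have h : ∀ x, |p i x - p₀ x| = (p i x - p₀ x) + 2 * max (p₀ x - p i x) 0 := by
        intro x
        rcases le_total (p i x) (p₀ x) with h | h
        · rw [abs_of_nonpos (by linarith), max_eq_left (by linarith)]; ring
        · rw [abs_of_nonneg (by linarith), max_eq_right (by linarith)]; ring
      have h1 : Integrable (fun x => p i x - p₀ x) μ := (hp_int i).sub hp₀_int
      have h2 : Integrable (fun x => 2 * max (p₀ x - p i x) 0) μ :=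
        (hp₀_int.sub (hp_int i)).pos_part.const_mul 2
      simp_rw [h]
      rw [integral_add h1 h2, integral_sub (hp_int i) hp₀_int,
        hp_one, hp₀_one, integral_const_mul]
      ring
    simp_rw [heq]
    simpa using hdiff.const_mul 2
  have hp₀f : ∀ᶠ i in l, Integrable (fun x => p₀ x * f i x) μ := by
    filter_upwards [hf, hC] with i hi hi'
    exact hp₀_int.mul_bdd hi.aestronglyMeasurable (ae_of_all _ hi')
  have h1 : Tendsto (fun i => ∫ x, p₀ x * f i x ∂μ) l (𝓝 (∫ x, p₀ x * f₀ x ∂μ)) := by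
    refine tendsto_integral_filter_of_dominated_convergence (fun x => p₀ x * C)
      (hp₀f.mono fun i hi => hi.aestronglyMeasurable) ?_ (hp₀_int.mul_const C)
      (ae_of_all _ fun x => (hf_lim x).const_mul _)
    filter_upwards [hC] with i hi
    refine ae_of_all _ fun x => ?_
    rw [Real.norm_eq_abs, abs_mul, abs_of_nonneg (hp₀_nonneg x)]
    exact mul_le_mul_of_nonneg_left (hi x) (hp₀_nonneg x)
  -- Replacing `p₀` by `p i` costs at most `C` times their `L¹` distance.
  have h2 : Tendsto (fun i => ∫ x, p i x * f i x ∂μ - ∫ x, p₀ x * f i x ∂μ) l (𝓝 0) := by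
    have hb : Tendsto (fun i => C * ∫ x, |p i x - p₀ x| ∂μ) l (𝓝 0) := by
      simpa using habs.const_mul C
    refine squeeze_zero_norm' ?_ hb
    filter_upwards [hp₀f, hf, hC] with i hi hi' hi''
    have hpf : Integrable (fun x => p i x * f i x) μ :=
      (hp_int i).mul_bdd hi'.aestronglyMeasurable (ae_of_all _ hi'')
    rw [← integral_sub hpf hi, ← integral_const_mul]
    refine norm_integral_le_of_norm_le (((hp_int i).sub hp₀_int).abs.const_mul C)
      (ae_of_all _ fun x => ?_)
    rw [← sub_mul, Real.norm_eq_abs, abs_mul, mul_comm]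
    exact mul_le_mul_of_nonneg_right (hi'' x) (abs_nonneg _)
  simpa using h2.add h1

/-! ### The closed loop of a policy -/

namespace MDP

variable {S : Type*} [MeasurableSpace S] {na nθ : ℕ} {M : MDP S na} {pol : S → Vec na}

lemma measurable_trans_policy (hpol : M.IsPolicy pol) :
    Measurable fun x : S × S => M.trans x.1 (pol x.1) x.2 :=
  M.measurable_trans.comp
    (measurable_fst.prodMk ((hpol.1.comp measurable_fst).prodMk measurable_snd))

lemma measurable_trans_right (M : MDP S na) (s : S) (a : Vec na) : Measurable (M.trans s a) :=
  M.measurable_trans.comp (measurable_const.prodMk (measurable_const.prodMk measurable_id))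

lemma integrable_trans (M : MDP S na) (s : S) {a : Vec na} (ha : a ∈ M.actions) :
    Integrable (M.trans s a) M.base := by
  refine ⟨(M.measurable_trans_right s a).aestronglyMeasurable, ?_⟩
  rw [hasFiniteIntegral_iff_ofReal (ae_of_all _ (M.trans_nonneg s a ha)), M.trans_total s a ha]
  exact ENNReal.one_lt_top

lemma integral_trans (M : MDP S na) (s : S) {a : Vec na} (ha : a ∈ M.actions) :
    ∫ s', M.trans s a s' ∂M.base = 1 := by
  rw [integral_eq_lintegral_of_nonneg_ae (ae_of_all _ (M.trans_nonneg s a ha))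
    (M.measurable_trans_right s a).aestronglyMeasurable, M.trans_total s a ha]
  simp

lemma abs_integral_trans_mul_le (M : MDP S na) (s : S) {a : Vec na} (ha : a ∈ M.actions)
    {f : S → ℝ} {C : ℝ} (hC : ∀ x, |f x| ≤ C) :
    |∫ s', M.trans s a s' * f s' ∂M.base| ≤ C := by
  have h := norm_integral_le_of_norm_le (μ := M.base) (f := fun s' => M.trans s a s' * f s')
    ((M.integrable_trans s ha).mul_const C) (ae_of_all _ fun x => by
      rw [Real.norm_eq_abs, abs_mul, abs_of_nonneg (M.trans_nonneg s a ha x)]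
      exact mul_le_mul_of_nonneg_left (hC x) (M.trans_nonneg s a ha x))
  rwa [integral_mul_const, M.integral_trans s ha, one_mul] at h

lemma isProbabilityMeasure_nextDist (hpol : M.IsPolicy pol) (s : S) :
    IsProbabilityMeasure (M.nextDist pol s) :=
  ⟨by simp [nextDist, M.trans_total s _ (hpol.2 s)]⟩

lemma measurable_nextDist (hpol : M.IsPolicy pol) : Measurable (M.nextDist pol) := by
  have := M.base_sigmaFinite
  refine Measure.measurable_of_measurable_coe _ fun t ht => ?_
  simp_rw [nextDist, withDensity_apply _ ht]
  exact Measurable.lintegral_prod_right'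
    (f := fun x : S × S => ENNReal.ofReal (M.trans x.1 (pol x.1) x.2))
    (measurable_trans_policy hpol).ennreal_ofReal

lemma integral_nextDist (hpol : M.IsPolicy pol) (s : S) (f : S → ℝ) :
    ∫ s', f s' ∂M.nextDist pol s = ∫ s', M.trans s (pol s) s' * f s' ∂M.base := by
  rw [nextDist, integral_withDensity_eq_integral_toReal_smul
    (M.measurable_trans_right s _).ennreal_ofReal (ae_of_all _ fun _ => ENNReal.ofReal_lt_top)]
  refine integral_congr_ae (ae_of_all _ fun x => ?_)
  simp [ENNReal.toReal_ofReal (M.trans_nonneg s _ (hpol.2 s) x)]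

lemma isProbabilityMeasure_stateDist (hpol : M.IsPolicy pol) (μ : Measure S)
    [IsProbabilityMeasure μ] (n : ℕ) : IsProbabilityMeasure (M.stateDist pol μ n) := by
  induction n with
  | zero => assumption
  | succ n ih =>
    exact isProbabilityMeasure_bind (measurable_nextDist hpol).aemeasurable
      (ae_of_all _ (isProbabilityMeasure_nextDist hpol))

lemma integral_stateDist_succ (hpol : M.IsPolicy pol) (μ : Measure S)
    [IsProbabilityMeasure μ] (n : ℕ) {f : S → ℝ} (hf : Measurable f) {C : ℝ}
    (hC : ∀ x, |f x| ≤ C) :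
    ∫ x, f x ∂M.stateDist pol μ (n + 1) =
      ∫ s, ∫ x, f x ∂M.nextDist pol s ∂M.stateDist pol μ n := by
  have := isProbabilityMeasure_stateDist hpol μ n
  exact integral_bind_of_abs_le (measurable_nextDist hpol) (isProbabilityMeasure_nextDist hpol)
    hf hC

lemma measurable_stateDist_dirac (hpol : M.IsPolicy pol) (n : ℕ) :
    Measurable fun s => M.stateDist pol (Measure.dirac s) n := by
  induction n with
  | zero => exact Measure.measurable_dirac
  | succ n ih => exact (Measure.measurable_bind' (measurable_nextDist hpol)).comp ih

/-- Associativity of `bind`: the closed loop depends linearly on the initial distribution. This is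
what links values of single states to averages such as `J`. -/
lemma stateDist_eq_bind (hpol : M.IsPolicy pol) (μ : Measure S) (n : ℕ) :
    M.stateDist pol μ n = μ.bind fun s => M.stateDist pol (Measure.dirac s) n := by
  induction n with
  | zero => exact Measure.bind_dirac.symm
  | succ n ih =>
    rw [stateDist, ih, Measure.bind_bind (measurable_stateDist_dirac hpol n).aemeasurable
      (measurable_nextDist hpol).aemeasurable]
    rfl

/-! ### Discounted sums along the closed loop -/

/-- The expectation of `∑ₙ γⁿ f(sₙ)` in closed loop with the policy `pol`, if `s₀ ∼ μ`. -/
def discountedSum (M : MDP S na) (pol : S → Vec na) (μ : Measure S) (f : S → ℝ) : ℝ :=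
  ∑' n : ℕ, M.discount ^ n * ∫ x, f x ∂M.stateDist pol μ n

section

variable (hγ : M.discount < 1) (hpol : M.IsPolicy pol) (μ : Measure S) [IsProbabilityMeasure μ]

include hpol in
lemma abs_discountedSum_term_le {f : S → ℝ} {C : ℝ} (hC : ∀ x, |f x| ≤ C) (n : ℕ) :
    |M.discount ^ n * ∫ x, f x ∂M.stateDist pol μ n| ≤ M.discount ^ n * C := by
  have := isProbabilityMeasure_stateDist hpol μ n
  have h := M.discount_pos.le
  rw [abs_mul, abs_of_nonneg (by positivity)]
  exact mul_le_mul_of_nonneg_left (abs_integral_le_of_abs_le hC) (by positivity)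

include hγ hpol

lemma summable_discountedSum {f : S → ℝ} {C : ℝ} (hC : ∀ x, |f x| ≤ C) :
    Summable fun n : ℕ => M.discount ^ n * ∫ x, f x ∂M.stateDist pol μ n :=
  Summable.of_norm_bounded ((summable_geometric_of_lt_one M.discount_pos.le hγ).mul_right C)
    (abs_discountedSum_term_le hpol μ hC)

lemma abs_discountedSum_le {f : S → ℝ} {C : ℝ} (hC : ∀ x, |f x| ≤ C) :
    |M.discountedSum pol μ f| ≤ (1 - M.discount)⁻¹ * C := by
  refine tsum_of_norm_bounded (f := fun n : ℕ => M.discount ^ n * ∫ x, f x ∂M.stateDist pol μ n)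
    ?_ (abs_discountedSum_term_le hpol μ hC)
  exact (hasSum_geometric_of_lt_one M.discount_pos.le hγ).mul_right C

lemma discountedSum_sub {f g : S → ℝ} (hf : Measurable f) (hg : Measurable g) {C C' : ℝ}
    (hC : ∀ x, |f x| ≤ C) (hC' : ∀ x, |g x| ≤ C') :
    M.discountedSum pol μ (fun x => f x - g x) =
      M.discountedSum pol μ f - M.discountedSum pol μ g := by
  rw [discountedSum, discountedSum, discountedSum,
    ← (summable_discountedSum hγ hpol μ hC).tsum_sub (summable_discountedSum hγ hpol μ hC')]
  refine tsum_congr fun n => ?_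
  have := isProbabilityMeasure_stateDist hpol μ n
  rw [integral_sub (integrable_of_abs_le hf hC) (integrable_of_abs_le hg hC')]
  ring

omit [IsProbabilityMeasure μ] hγ hpol in
lemma discountedSum_const_mul (f : S → ℝ) (c : ℝ) :
    M.discountedSum pol μ (fun x => c * f x) = c * M.discountedSum pol μ f := by
  rw [discountedSum, discountedSum, ← tsum_mul_left]
  refine tsum_congr fun n => ?_
  rw [integral_const_mul]
  ring

lemma discountedSum_sum {ι : Type*} (t : Finset ι) {f : ι → S → ℝ}
    (hf : ∀ i, Measurable (f i)) {C : ι → ℝ} (hC : ∀ i x, |f i x| ≤ C i) :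
    M.discountedSum pol μ (fun x => ∑ i ∈ t, f i x) = ∑ i ∈ t, M.discountedSum pol μ (f i) := by
  simp_rw [discountedSum]
  rw [← Summable.tsum_finsetSum fun i _ => summable_discountedSum hγ hpol μ (hC i)]
  refine tsum_congr fun n => ?_
  have := isProbabilityMeasure_stateDist hpol μ n
  rw [integral_finsetSum _ fun i _ => integrable_of_abs_le (hf i) (hC i), Finset.mul_sum]

/-- The discounted differences `f(sₙ) - γ f(sₙ₊₁)` telescope. -/
lemma discountedSum_sub_next {f : S → ℝ} (hf : Measurable f) {C : ℝ} (hC : ∀ x, |f x| ≤ C) :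
    M.discountedSum pol μ (fun s => f s - M.discount * ∫ x, f x ∂M.nextDist pol s) =
      ∫ x, f x ∂μ := by
  have hnext : Measurable fun s => ∫ x, f x ∂M.nextDist pol s :=
    measurable_integral_of_measurable (measurable_nextDist hpol)
      (isProbabilityMeasure_nextDist hpol) hf
  have hnextC : ∀ s, |∫ x, f x ∂M.nextDist pol s| ≤ C := fun s =>
    have := isProbabilityMeasure_nextDist hpol s
    abs_integral_le_of_abs_le hC
  have hγnextC : ∀ s, |M.discount * ∫ x, f x ∂M.nextDist pol s| ≤ M.discount * C := fun s => by
    rw [abs_mul, abs_of_pos M.discount_pos]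
    exact mul_le_mul_of_nonneg_left (hnextC s) M.discount_pos.le
  rw [discountedSum_sub hγ hpol μ hf (hnext.const_mul _) hC hγnextC, discountedSum_const_mul]
  -- The term `n = 0` is the claimed integral; the others, shifted by one, cancel against the
  -- subtracted series.
  rw [discountedSum, (summable_discountedSum hγ hpol μ hC).tsum_eq_zero_add, discountedSum,
    ← tsum_mul_left]
  have : ∀ n : ℕ, M.discount ^ (n + 1) * ∫ x, f x ∂M.stateDist pol μ (n + 1) =
      M.discount * (M.discount ^ n * ∫ s, ∫ x, f x ∂M.nextDist pol s ∂M.stateDist pol μ n) := by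
    intro n
    rw [integral_stateDist_succ hpol μ n hf hC]
    ring
  simp_rw [this]
  simp [stateDist]

lemma integrable_occupancy {f : S → ℝ} (hf : Measurable f) {C : ℝ} (hC : ∀ x, |f x| ≤ C) :
    Integrable f (M.occupancy pol) := by
  have := M.init_prob
  refine integrable_sum_measure (fun n => ?_) ?_
  · have := isProbabilityMeasure_stateDist hpol M.init n
    exact (integrable_of_abs_le hf hC).smul_measure ENNReal.ofReal_ne_top
  · refine (summable_discountedSum hγ hpol M.init (f := fun x => ‖f x‖) (C := C)
      (by simpa using hC)).congr fun n => ?_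
    rw [integral_smul_measure, ENNReal.toReal_ofReal (pow_nonneg M.discount_pos.le n), smul_eq_mul]

lemma integral_occupancy {f : S → ℝ} (hf : Measurable f) {C : ℝ} (hC : ∀ x, |f x| ≤ C) :
    ∫ x, f x ∂M.occupancy pol = M.discountedSum pol M.init f := by
  rw [occupancy, integral_sum_measure (integrable_occupancy hγ hpol hf hC)]
  refine tsum_congr fun n => ?_
  rw [integral_smul_measure, ENNReal.toReal_ofReal (pow_nonneg M.discount_pos.le n), smul_eq_mul]

omit [IsProbabilityMeasure μ] hγ in
lemma measurable_discountedSum_dirac {f : S → ℝ} (hf : Measurable f) :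
    Measurable fun s => M.discountedSum pol (Measure.dirac s) f :=
  Measurable.tsum fun n => Measurable.const_mul (measurable_integral_of_measurable
    (measurable_stateDist_dirac hpol n)
    (fun s => isProbabilityMeasure_stateDist hpol (Measure.dirac s) n) hf) _

lemma integral_discountedSum_dirac {f : S → ℝ} (hf : Measurable f) {C : ℝ}
    (hC : ∀ x, |f x| ≤ C) :
    ∫ s, M.discountedSum pol (Measure.dirac s) f ∂μ = M.discountedSum pol μ f := by
  have hmeas : ∀ n : ℕ, Measurable fun s =>
      M.discount ^ n * ∫ x, f x ∂M.stateDist pol (Measure.dirac s) n := fun n =>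
    (measurable_integral_of_measurable (measurable_stateDist_dirac hpol n)
      (fun s => isProbabilityMeasure_stateDist hpol (Measure.dirac s) n) hf).const_mul _
  have hle : ∀ (n : ℕ) s, |M.discount ^ n * ∫ x, f x ∂M.stateDist pol (Measure.dirac s) n| ≤
      M.discount ^ n * C := fun n s => abs_discountedSum_term_le hpol _ hC n
  simp_rw [discountedSum]
  rw [← integral_tsum_of_summable_integral_norm
    (fun n => integrable_of_abs_le (hmeas n) (hle n))]
  · refine tsum_congr fun n => ?_
    rw [integral_const_mul, stateDist_eq_bind hpol μ n,
      integral_bind_of_abs_le (measurable_stateDist_dirac hpol n)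
        (fun s => isProbabilityMeasure_stateDist hpol (Measure.dirac s) n) hf hC]
  · refine Summable.of_norm_bounded
      ((summable_geometric_of_lt_one M.discount_pos.le hγ).mul_right C) fun n => ?_
    exact abs_integral_le_of_abs_le fun s => by rw [Real.norm_eq_abs, abs_abs]; exact hle n s

end

/-- Continuity of discounted sums in the policy and the summand. -/
lemma tendsto_discountedSum {ι : Type*} {l : Filter ι} [l.IsCountablyGenerated]
    (hγ : M.discount < 1)
    (hp : ∀ s s', ContinuousOn (fun a => M.trans s a s') (interior M.actions))
    {p : ι → S → Vec na} {p₀ : S → Vec na} (hpol : ∀ i, M.IsPolicy (p i)) (hpol₀ : M.IsPolicy p₀)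
    (hint : ∀ s, p₀ s ∈ interior M.actions)
    (hlim : ∀ s, Tendsto (fun i => p i s) l (𝓝 (p₀ s)))
    (μ : Measure S) [IsProbabilityMeasure μ] {f : ι → S → ℝ} {f₀ : S → ℝ} {C : ℝ}
    (hf : ∀ᶠ i in l, Measurable (f i)) (hf₀ : Measurable f₀)
    (hC : ∀ᶠ i in l, ∀ x, |f i x| ≤ C) (hC₀ : ∀ x, |f₀ x| ≤ C)
    (hf_lim : ∀ x, Tendsto (fun i => f i x) l (𝓝 (f₀ x))) :
    Tendsto (fun i => M.discountedSum (p i) μ (f i)) l (𝓝 (M.discountedSum p₀ μ f₀)) := by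
  -- The summands are quantified inside, because the induction replaces them by their one-step
  -- expectations, which depend on the policy as well. The bound `C` survives this.
  have hstate : ∀ n : ℕ, ∀ (f : ι → S → ℝ) (f₀ : S → ℝ), (∀ᶠ i in l, Measurable (f i)) →
      Measurable f₀ → (∀ᶠ i in l, ∀ x, |f i x| ≤ C) → (∀ x, |f₀ x| ≤ C) →
      (∀ x, Tendsto (fun i => f i x) l (𝓝 (f₀ x))) →
      Tendsto (fun i => ∫ x, f i x ∂M.stateDist (p i) μ n) l
        (𝓝 (∫ x, f₀ x ∂M.stateDist p₀ μ n)) := by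
    intro n
    induction n with
    | zero =>
      intro f f₀ hf _ hC _ hf_lim
      exact tendsto_integral_filter_of_dominated_convergence (fun _ => C)
        (hf.mono fun i hi => hi.aestronglyMeasurable) (hC.mono fun i hi => ae_of_all _ hi)
        (integrable_const C) (ae_of_all _ hf_lim)
    | succ n ih =>
      intro f f₀ hf hf₀ hC hC₀ hf_lim
      have hlimit := ih (fun i s => ∫ x, f i x ∂M.nextDist (p i) s)
        (fun s => ∫ x, f₀ x ∂M.nextDist p₀ s)
        (hf.mono fun i hi => measurable_integral_of_measurable (measurable_nextDist (hpol i))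
          (isProbabilityMeasure_nextDist (hpol i)) hi)
        (measurable_integral_of_measurable (measurable_nextDist hpol₀)
          (isProbabilityMeasure_nextDist hpol₀) hf₀)
        (hC.mono fun i hi s =>
          have := isProbabilityMeasure_nextDist (hpol i) s
          abs_integral_le_of_abs_le hi)
        (fun s =>
          have := isProbabilityMeasure_nextDist hpol₀ s
          abs_integral_le_of_abs_le hC₀)
        (fun s => by
          simp_rw [integral_nextDist hpol₀, fun i => integral_nextDist (hpol i) s (f i)]
          refine tendsto_integral_mul_density (fun i => M.trans_nonneg s _ ((hpol i).2 s))
            (fun i => M.integrable_trans s ((hpol i).2 s))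
            (fun i => M.integral_trans s ((hpol i).2 s)) (M.trans_nonneg s _ (hpol₀.2 s))
            (M.integrable_trans s (hpol₀.2 s)) (M.integral_trans s (hpol₀.2 s)) (fun s' => ?_)
            hf hC hf_lim
          exact ((hp s s').continuousAt (isOpen_interior.mem_nhds (hint s))).tendsto.comp (hlim s))
      rw [integral_stateDist_succ hpol₀ μ n hf₀ hC₀]
      refine hlimit.congr' ?_
      filter_upwards [hf, hC] with i hi hi'
      rw [integral_stateDist_succ (hpol i) μ n hi hi']
  refine tendsto_tsum_of_dominated_convergence
    ((summable_geometric_of_lt_one M.discount_pos.le hγ).mul_right C)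
    (fun n => (hstate n f f₀ hf hf₀ hC hC₀ hf_lim).const_mul _) ?_
  filter_upwards [hC] with i hi n
  exact abs_discountedSum_term_le (hpol i) μ hi n

end MDP

namespace MDP

variable {S : Type*} [MeasurableSpace S] {na nθ : ℕ} {M : MDP S na} {pol pol' : S → Vec na}
  {B : ℝ}

/-! ### Value functions -/

lemma measurable_reward_policy (hpol : M.IsPolicy pol) :
    Measurable fun s => M.reward s (pol s) :=
  M.measurable_reward.comp (measurable_id.prodMk hpol.1)

lemma measurable_V (hpol : M.IsPolicy pol) : Measurable (M.V pol) :=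
  measurable_discountedSum_dirac hpol (measurable_reward_policy hpol)

lemma measurable_Q (hpol : M.IsPolicy pol) :
    Measurable fun x : S × Vec na => M.Q pol x.1 x.2 := by
  have := M.base_sigmaFinite
  refine M.measurable_reward.add (Measurable.const_mul ?_ _)
  have h : Measurable fun y : (S × Vec na) × S => M.trans y.1.1 y.1.2 y.2 * M.V pol y.2 :=
    (M.measurable_trans.comp ((measurable_fst.comp measurable_fst).prodMk
      ((measurable_snd.comp measurable_fst).prodMk measurable_snd))).mul
      ((measurable_V hpol).comp measurable_snd)
  exact h.stronglyMeasurable.integral_prod_right'.measurable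

section

variable (hγ : M.discount < 1) (hR : ∀ s, ∀ a ∈ M.actions, |M.reward s a| ≤ B)
  (hpol : M.IsPolicy pol)

include hγ hR hpol

lemma abs_V_le (s : S) : |M.V pol s| ≤ (1 - M.discount)⁻¹ * B :=
  abs_discountedSum_le hγ hpol _ fun x => hR x _ (hpol.2 x)

lemma integral_V (μ : Measure S) [IsProbabilityMeasure μ] :
    ∫ s, M.V pol s ∂μ = M.discountedSum pol μ fun s => M.reward s (pol s) :=
  integral_discountedSum_dirac hγ hpol μ (measurable_reward_policy hpol)
    fun x => hR x _ (hpol.2 x)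

omit hγ hR hpol in
lemma Q_policy (hpol' : M.IsPolicy pol') (s : S) :
    M.Q pol s (pol' s) =
      M.reward s (pol' s) + M.discount * ∫ x, M.V pol x ∂M.nextDist pol' s := by
  rw [Q, integral_nextDist hpol']

lemma abs_Q_le (s : S) {a : Vec na} (ha : a ∈ M.actions) :
    |M.Q pol s a| ≤ B + M.discount * ((1 - M.discount)⁻¹ * B) := by
  refine (abs_add_le _ _).trans (add_le_add (hR s a ha) ?_)
  rw [abs_mul, abs_of_pos M.discount_pos]
  exact mul_le_mul_of_nonneg_left (M.abs_integral_trans_mul_le s ha (abs_V_le hγ hR hpol))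
    M.discount_pos.le

/-- The Bellman equation. -/
lemma Q_self (s : S) : M.Q pol s (pol s) = M.V pol s := by
  -- `stateDist` appends transitions at the end, whereas the Bellman equation splits off the first
  -- one.
  have hshift : ∀ n, M.stateDist pol (Measure.dirac s) (n + 1) =
      M.stateDist pol (M.nextDist pol s) n := by
    intro n
    induction n with
    | zero => exact Measure.dirac_bind (measurable_nextDist hpol) s
    | succ n ih => rw [stateDist, ih, stateDist]
  have := isProbabilityMeasure_nextDist hpol s
  have hrew := measurable_reward_policy hpol
  rw [Q_policy hpol, integral_V hγ hR hpol, V,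
    (summable_discountedSum hγ hpol (Measure.dirac s) fun x => hR x _ (hpol.2 x)).tsum_eq_zero_add,
    discountedSum, ← tsum_mul_left]
  congr 1
  · simp [stateDist, integral_dirac' _ _ hrew.stronglyMeasurable]
  · refine tsum_congr fun n => ?_
    rw [hshift]
    ring

/-- The performance difference lemma. -/
lemma integral_V_sub_integral_V (hpol' : M.IsPolicy pol') (μ : Measure S)
    [IsProbabilityMeasure μ] :
    ∫ s, M.V pol' s ∂μ - ∫ s, M.V pol s ∂μ =
      M.discountedSum pol' μ fun s => M.Q pol s (pol' s) - M.Q pol s (pol s) := by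
  have hV := measurable_V hpol
  have hVB := abs_V_le hγ hR hpol
  have hnext : Measurable fun s => ∫ x, M.V pol x ∂M.nextDist pol' s :=
    measurable_integral_of_measurable (measurable_nextDist hpol')
      (isProbabilityMeasure_nextDist hpol') hV
  have hbound : ∀ s, |M.V pol s - M.discount * ∫ x, M.V pol x ∂M.nextDist pol' s| ≤
      (1 - M.discount)⁻¹ * B + M.discount * ((1 - M.discount)⁻¹ * B) := fun s => by
    have := isProbabilityMeasure_nextDist hpol' s
    refine (abs_sub _ _).trans (add_le_add (hVB s) ?_)
    rw [abs_mul, abs_of_pos M.discount_pos]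
    exact mul_le_mul_of_nonneg_left (abs_integral_le_of_abs_le hVB) M.discount_pos.le
  have hdiff : Measurable fun s =>
      M.V pol s - M.discount * ∫ x, M.V pol x ∂M.nextDist pol' s := hV.sub (hnext.const_mul _)
  -- The value of `pol` is telescoped along the closed loop of `pol'`, so that both terms become
  -- sums over the same trajectory.
  rw [integral_V hγ hR hpol', ← discountedSum_sub_next hγ hpol' μ hV hVB,
    ← discountedSum_sub hγ hpol' μ (measurable_reward_policy hpol')
      hdiff (fun x => hR x _ (hpol'.2 x)) hbound]
  congr 1
  funext s
  rw [Q_self hγ hR hpol, Q_policy hpol']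
  ring

lemma V_sub_V (hpol' : M.IsPolicy pol') (s : S) :
    M.V pol' s - M.V pol s =
      M.discountedSum pol' (Measure.dirac s) fun x => M.Q pol x (pol' x) - M.Q pol x (pol x) := by
  rw [← integral_V_sub_integral_V hγ hR hpol hpol',
    integral_dirac' _ _ (measurable_V hpol').stronglyMeasurable,
    integral_dirac' _ _ (measurable_V hpol).stronglyMeasurable]

lemma J_sub_J (hpol' : M.IsPolicy pol') :
    M.J pol' - M.J pol =
      M.discountedSum pol' M.init fun s => M.Q pol s (pol' s) - M.Q pol s (pol s) :=
  have := M.init_prob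
  integral_V_sub_integral_V hγ hR hpol hpol' M.init

lemma abs_Q_sub_Q_le (hpol' : M.IsPolicy pol') {C : ℝ}
    (hC : ∀ s, |M.V pol' s - M.V pol s| ≤ C) (s : S) {a : Vec na} (ha : a ∈ M.actions) :
    |M.Q pol' s a - M.Q pol s a| ≤ C := by
  have hint : ∀ {p : S → Vec na}, M.IsPolicy p →
      Integrable (fun s' => M.trans s a s' * M.V p s') M.base := fun hp =>
    (M.integrable_trans s ha).mul_bdd (measurable_V hp).aestronglyMeasurable
      (ae_of_all _ (abs_V_le hγ hR hp))
  have heq : M.Q pol' s a - M.Q pol s a =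
      M.discount * ∫ s', M.trans s a s' * (M.V pol' s' - M.V pol s') ∂M.base := by
    simp_rw [mul_sub]
    rw [integral_sub (hint hpol') (hint hpol), Q, Q]
    ring
  have hle := M.abs_integral_trans_mul_le s ha hC
  rw [heq, abs_mul, abs_of_pos M.discount_pos]
  calc _ ≤ 1 * |∫ s', M.trans s a s' * (M.V pol' s' - M.V pol s') ∂M.base| :=
        mul_le_mul_of_nonneg_right hγ.le (abs_nonneg _)
    _ ≤ C := by rwa [one_mul]

/-- Against an optimal policy, no single action has an advantage. -/
lemma IsOptimal.Q_le [MeasurableSingletonClass S] (hopt : M.IsOptimal pol) (s : S)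
    {a : Vec na} (ha : a ∈ M.actions) : M.Q pol s a ≤ M.Q pol s (pol s) := by
  classical
  by_contra! hlt
  -- The deviation takes place at every visit to `s`. Its advantages are nonnegative everywhere, so
  -- later visits cannot undo the gain of the first.
  let p : S → Vec na := Function.update pol s a
  have hp : M.IsPolicy p := by
    refine ⟨?_, fun x => ?_⟩
    · have : p = fun x => if x = s then a else pol x := by
        funext x; simp [p, Function.update_apply]
      rw [this]
      exact Measurable.ite (measurableSet_singleton s) measurable_const hopt.1.1
    · by_cases hx : x = s
      · subst hx; simpa [p] using ha
      · simpa [p, hx] using hopt.1.2 x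
  set f : S → ℝ := fun x => M.Q pol x (p x) - M.Q pol x (pol x) with hf
  have hf0 : ∀ x, 0 ≤ f x := fun x => by
    by_cases hx : x = s
    · subst hx; simpa [f, p] using hlt.le
    · simp [f, p, hx]
  have hfs : 0 < f s := by simpa [f, p] using hlt
  have hfm : Measurable f := by
    exact ((measurable_Q hpol).comp (measurable_id.prodMk hp.1)).sub
      ((measurable_Q hpol).comp (measurable_id.prodMk hpol.1))
  have hfC : ∀ x, |f x| ≤ (B + M.discount * ((1 - M.discount)⁻¹ * B)) +
      (B + M.discount * ((1 - M.discount)⁻¹ * B)) := fun x =>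
    (abs_sub _ _).trans (add_le_add (abs_Q_le hγ hR hpol x (hp.2 x))
      (abs_Q_le hγ hR hpol x (hpol.2 x)))
  have hsum := summable_discountedSum hγ hp (Measure.dirac s) hfC
  -- The term `n = 0` is positive, as the loop starts in `s`.
  have hpos : 0 < M.discountedSum p (Measure.dirac s) f := by
    refine hsum.tsum_pos (fun n => mul_nonneg (pow_nonneg M.discount_pos.le n)
      (integral_nonneg hf0)) 0 ?_
    simpa [stateDist, integral_dirac' _ _ hfm.stronglyMeasurable] using hfs
  have := V_sub_V hγ hR hpol hp s
  have hle := hopt.2 p hp s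
  linarith

end

end MDP

/-! ### Derivatives -/

/-- The derivative is a pointwise limit of a sequence of difference quotients, so measurability in
`s` is needed only for each fixed step length. -/
lemma measurable_fderiv_apply {S E : Type*} [MeasurableSpace S] [NormedAddCommGroup E]
    [NormedSpace ℝ E] {f : S → E → ℝ} {f' : S → E →L[ℝ] ℝ} {b : S → E} (v : E)
    (hd : ∀ s, HasFDerivAt (f s) (f' s) (b s)) (hb : Measurable fun s => f s (b s)) {δ : ℝ}
    (hδ : 0 < δ) (hm : ∀ t : ℝ, 0 < t → t < δ → Measurable fun s => f s (b s + t • v)) :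
    Measurable fun s => f' s v := by
  -- The steps `1 / (k + N)` stay below `δ` for all `k`, including `k = 0`.
  obtain ⟨N, hN⟩ := exists_nat_gt δ⁻¹
  let c : ℕ → ℝ := fun k => (k : ℝ) + N
  have hc : Tendsto (fun k => ‖c k‖) atTop atTop :=
    tendsto_norm_atTop_atTop.comp (tendsto_natCast_atTop_atTop.atTop_add tendsto_const_nhds)
  have hN0 : (0 : ℝ) < N := (inv_pos.mpr hδ).trans hN
  have hc0 : ∀ k, 0 < c k := fun k => by positivity
  refine measurable_of_tendsto_metrizable
    (f := fun k s => c k • (f s (b s + (c k)⁻¹ • v) - f s (b s))) (fun k => ?_)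
    (tendsto_pi_nhds.mpr fun s => (hd s).lim v hc)
  refine ((hm (c k)⁻¹ (inv_pos.mpr (hc0 k)) ?_).sub hb).const_smul (c k)
  refine inv_lt_of_inv_lt₀ hδ (hN.trans_le ?_)
  simp [c]

lemma Vec.apply_eq_sum {n : ℕ} {F : Type*} [NormedAddCommGroup F] [NormedSpace ℝ F]
    (L : Vec n →L[ℝ] F) (v : Vec n) : L v = ∑ i, v i • L (EuclideanSpace.single i 1) := by
  conv_lhs => rw [← (EuclideanSpace.basisFun (Fin n) ℝ).sum_repr v]
  simp

lemma Vec.abs_apply_le {n : ℕ} (v : Vec n) (i : Fin n) : |v i| ≤ ‖v‖ :=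
  PiLp.norm_apply_le v i

namespace MDP

variable {S : Type*} [MeasurableSpace S] {na nθ : ℕ} {M : MDP S na}

/-- Differentiation of discounted sums at a parameter where all summands vanish. -/
lemma exists_hasFDerivAt_discountedSum (hγ : M.discount < 1)
    (hp : ∀ s s', ContinuousOn (fun a => M.trans s a s') (interior M.actions))
    {p : Vec nθ → S → Vec na} (hpol : ∀ θ, M.IsPolicy (p θ)) {θ₀ : Vec nθ}
    (hint : ∀ s, p θ₀ s ∈ interior M.actions) (hcont : ∀ s, ContinuousAt (fun θ => p θ s) θ₀)
    (μ : Measure S) [IsProbabilityMeasure μ] {Φ : Vec nθ → S → ℝ} {Φ' : S → Vec nθ →L[ℝ] ℝ}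
    {K : ℝ} (hK : 0 ≤ K) (hΦm : ∀ᶠ θ in 𝓝 θ₀, Measurable (Φ θ))
    (hΦK : ∀ᶠ θ in 𝓝 θ₀, ∀ s, |Φ θ s| ≤ K * ‖θ - θ₀‖)
    (hΦ' : ∀ s, HasFDerivAt (fun θ => Φ θ s) (Φ' s) θ₀) :
    ∃ L : Vec nθ →L[ℝ] ℝ, HasFDerivAt (fun θ => M.discountedSum (p θ) μ (Φ θ)) L θ₀ ∧
      ∀ j, L (EuclideanSpace.single j 1) =
        M.discountedSum (p θ₀) μ fun s => Φ' s (EuclideanSpace.single j 1) := by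
  -- The linear bound at `θ = θ₀` itself forces the summand to vanish there.
  have hΦ0 : ∀ s, Φ θ₀ s = 0 := fun s => by simpa using hΦK.self_of_nhds s
  have hΦ'K : ∀ s, ‖Φ' s‖ ≤ K := fun s => (hΦ' s).le_of_lip' hK (by
    filter_upwards [hΦK] with θ hθ
    simpa [hΦ0] using hθ s)
  have hΦ'v : ∀ s v, |Φ' s v| ≤ K * ‖v‖ := fun s v => (Φ' s).le_of_opNorm_le (hΦ'K s) v
  have hΦ'm : ∀ v, Measurable fun s => Φ' s v := fun v => by
    have hline : Tendsto (fun t : ℝ => θ₀ + t • v) (𝓝 0) (𝓝 θ₀) := by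
      have : Continuous fun t : ℝ => θ₀ + t • v := by fun_prop
      simpa using this.tendsto 0
    obtain ⟨δ, hδ, hball⟩ := Metric.eventually_nhds_iff.mp (hline.eventually hΦm)
    refine measurable_fderiv_apply (f := fun s θ => Φ θ s) (b := fun _ => θ₀) v hΦ'
      hΦm.self_of_nhds hδ fun t ht htδ => hball ?_
    rwa [dist_zero_right, Real.norm_of_nonneg ht.le]
  let e : Fin nθ → Vec nθ := fun j => EuclideanSpace.single j 1
  have heK : ∀ j s, |Φ' s (e j)| ≤ K := fun j s => by simpa [e] using hΦ'v s (e j)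
  -- The derivative of the summand is fixed at `θ₀`, while the closed loop is that of `θ`; `D j` is
  -- continuous at `θ₀`.
  let D : Fin nθ → Vec nθ → ℝ := fun j θ => M.discountedSum (p θ) μ fun s => Φ' s (e j)
  have hD : ∀ j, Tendsto (fun θ => |D j θ - D j θ₀|) (𝓝 θ₀) (𝓝 0) := fun j => by
    have h := tendsto_discountedSum hγ hp hpol (hpol θ₀) hint hcont μ
      (f := fun _ s => Φ' s (e j)) (f₀ := fun s => Φ' s (e j)) (C := K)
      (Eventually.of_forall fun _ => hΦ'm _) (hΦ'm _) (Eventually.of_forall fun _ => heK j)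
      (heK j) fun _ => tendsto_const_nhds
    have h' : Tendsto (fun θ => |D j θ - D j θ₀|) (𝓝 θ₀) (𝓝 |D j θ₀ - D j θ₀|) :=
      (Tendsto.sub_const (f := D j) h (D j θ₀)).abs
    rwa [sub_self, abs_zero] at h'
  -- The normalized Taylor remainder tends to `0` for each `s` only, but is bounded by `2 * K`
  -- uniformly, which suffices for its discounted sum. At `θ₀` the inverse is `0` by convention.
  let G : Vec nθ → S → ℝ := fun θ s => ‖θ - θ₀‖⁻¹ * (Φ θ s - Φ' s (θ - θ₀))
  have hG : Tendsto (fun θ => |M.discountedSum (p θ) μ (G θ)|) (𝓝 θ₀) (𝓝 0) := by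
    have h := tendsto_discountedSum hγ hp hpol (hpol θ₀) hint hcont μ (f := G)
      (f₀ := fun _ => 0) (C := 2 * K) ?_ measurable_const ?_ (fun _ => by simpa using hK) ?_
    · have h0 : M.discountedSum (p θ₀) μ (fun _ => 0) = 0 := by simp [discountedSum]
      rw [h0] at h
      simpa using h.abs
    · filter_upwards [hΦm] with θ hθ
      exact (hθ.sub (hΦ'm _)).const_mul _
    · filter_upwards [hΦK] with θ hθ s
      rw [abs_mul, abs_of_nonneg (inv_nonneg.mpr (norm_nonneg _))]
      refine inv_mul_le_of_le_mul₀ (norm_nonneg _) (by positivity) ?_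
      refine (abs_sub _ _).trans ?_
      linarith [hθ s, hΦ'v s (θ - θ₀)]
    · intro s
      have := hasFDerivAt_iff_tendsto.mp (hΦ' s)
      simp_rw [hΦ0, sub_zero] at this
      refine squeeze_zero_norm (fun θ => ?_) this
      simp [G]
  let L : Vec nθ →L[ℝ] ℝ := ∑ j, D j θ₀ • EuclideanSpace.proj j
  have hL : ∀ v, L v = ∑ j, v j * D j θ₀ := fun v => by
    simp [L, mul_comm]
  refine ⟨L, ?_, fun j => by simp [hL, D, e]⟩
  rw [hasFDerivAt_iff_tendsto]
  have hlim : Tendsto (fun θ => |M.discountedSum (p θ) μ (G θ)| + ∑ j, |D j θ - D j θ₀|)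
      (𝓝 θ₀) (𝓝 0) := by
    simpa using hG.add (tendsto_finsetSum Finset.univ fun j _ => hD j)
  refine squeeze_zero' (Eventually.of_forall fun θ => by positivity) ?_ hlim
  filter_upwards [hΦm, hΦK] with θ hθm hθK
  have h0 : M.discountedSum (p θ₀) μ (Φ θ₀) = 0 := by simp [discountedSum, hΦ0]
  have h1 : M.discountedSum (p θ) μ (fun s => Φ' s (θ - θ₀)) = ∑ j, (θ - θ₀) j * D j θ := by
    simp_rw [Vec.apply_eq_sum (Φ' _) (θ - θ₀), smul_eq_mul]
    rw [discountedSum_sum hγ (hpol θ) μ Finset.univ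
      (f := fun j s => (θ - θ₀) j * Φ' s (EuclideanSpace.single j 1))
      (C := fun j => |(θ - θ₀) j| * K) (fun j => (hΦ'm _).const_mul _) fun j s => by
        rw [abs_mul]
        exact mul_le_mul_of_nonneg_left (heK j s) (abs_nonneg _)]
    exact Finset.sum_congr rfl fun j _ => discountedSum_const_mul μ _ _
  have h2 : ‖θ - θ₀‖⁻¹ * (M.discountedSum (p θ) μ (Φ θ) - ∑ j, (θ - θ₀) j * D j θ) =
      M.discountedSum (p θ) μ (G θ) := by
    rw [← h1, ← discountedSum_sub hγ (hpol θ) μ hθm (hΦ'm _) hθK fun s => hΦ'v s _,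
      ← discountedSum_const_mul]
  -- The error splits into the Taylor remainder and the effect of the changed state distribution.
  -- The latter multiplies a linear term in `θ - θ₀` by something that tends to `0`.
  have h3 : M.discountedSum (p θ) μ (Φ θ) - L (θ - θ₀) =
      (M.discountedSum (p θ) μ (Φ θ) - ∑ j, (θ - θ₀) j * D j θ) +
        ∑ j, (θ - θ₀) j * (D j θ - D j θ₀) := by
    simp_rw [hL, mul_sub, Finset.sum_sub_distrib]
    ring
  rw [h0, sub_zero, h3, ← Real.norm_of_nonneg (inv_nonneg.mpr (norm_nonneg (θ - θ₀))),
    ← norm_mul, mul_add, h2]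
  refine (norm_add_le _ _).trans (add_le_add le_rfl ?_)
  rw [Finset.mul_sum]
  refine (norm_sum_le _ _).trans (Finset.sum_le_sum fun j _ => ?_)
  rw [← mul_assoc, norm_mul, Real.norm_eq_abs (D j θ - D j θ₀)]
  refine mul_le_of_le_one_left (abs_nonneg _) ?_
  rw [norm_mul, norm_inv, norm_norm]
  exact inv_mul_le_one_of_le₀ (Vec.abs_apply_le _ j) (norm_nonneg _)

end MDP

/-! ### Norms and derivatives in coordinates -/

lemma Vec.opNorm_le_sum {n : ℕ} {F : Type*} [NormedAddCommGroup F] [NormedSpace ℝ F]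
    (L : Vec n →L[ℝ] F) : ‖L‖ ≤ ∑ i, ‖L (EuclideanSpace.single i 1)‖ := by
  refine L.opNorm_le_bound (by positivity) fun v => ?_
  rw [Vec.apply_eq_sum L v, Finset.sum_mul]
  refine (norm_sum_le _ _).trans (Finset.sum_le_sum fun i _ => ?_)
  rw [norm_smul, mul_comm]
  exact mul_le_mul_of_nonneg_left (Vec.abs_apply_le v i) (norm_nonneg _)

lemma Vec.norm_le_sum {n : ℕ} (v : Vec n) : ‖v‖ ≤ ∑ i, |v i| := by
  conv_lhs => rw [← (EuclideanSpace.basisFun (Fin n) ℝ).sum_repr v]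
  refine (norm_sum_le _ _).trans (le_of_eq ?_)
  simp [norm_smul]

lemma norm_fderiv_fderiv_sub_le {n : ℕ} (f g : Vec n → ℝ) (x y : Vec n) :
    ‖fderiv ℝ (fderiv ℝ f) x - fderiv ℝ (fderiv ℝ g) y‖ ≤
      ∑ i, ∑ j, |hess f x i j - hess g y i j| :=
  (Vec.opNorm_le_sum _).trans (Finset.sum_le_sum fun i _ =>
    (Vec.opNorm_le_sum _).trans (le_of_eq (by simp [hess])))

lemma norm_fderiv_fderiv_le {n : ℕ} {f : Vec n → ℝ} {x : Vec n} {C : ℝ}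
    (hC : ∀ i j, |hess f x i j| ≤ C) : ‖fderiv ℝ (fderiv ℝ f) x‖ ≤ n * (n * C) :=
  calc ‖fderiv ℝ (fderiv ℝ f) x‖ ≤ ∑ i, ‖fderiv ℝ (fderiv ℝ f) x (EuclideanSpace.single i 1)‖ :=
        Vec.opNorm_le_sum _
    _ ≤ ∑ _ : Fin n, ∑ _ : Fin n, C := Finset.sum_le_sum fun i _ =>
        (Vec.opNorm_le_sum _).trans (Finset.sum_le_sum fun j _ => hC i j)
    _ = n * (n * C) := by simp

lemma norm_fderiv_le {n : ℕ} {f : Vec n → ℝ} {x : Vec n} {C : ℝ}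
    (hC : ∀ i, |grad f x i| ≤ C) : ‖fderiv ℝ f x‖ ≤ n * C :=
  calc ‖fderiv ℝ f x‖ ≤ ∑ _ : Fin n, C :=
        (Vec.opNorm_le_sum _).trans (Finset.sum_le_sum fun i _ => hC i)
    _ = n * C := by simp

lemma fderiv_apply_coord {n m : ℕ} {g : Vec n → Vec m} {x : Vec n} (hg : DifferentiableAt ℝ g x)
    (v : Vec n) (i : Fin m) : fderiv ℝ g x v i = fderiv ℝ (fun y => g y i) x v := by
  have h := ((EuclideanSpace.proj i : Vec m →L[ℝ] ℝ).hasFDerivAt.comp x hg.hasFDerivAt).fderiv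
  exact (congrArg (fun L : Vec n →L[ℝ] ℝ => L v) h).symm

lemma norm_fderiv_le_of_jacobian {n m : ℕ} {g : Vec n → Vec m} {x : Vec n}
    (hg : DifferentiableAt ℝ g x) {C : ℝ} (hC : ∀ i j, |jacobian g x i j| ≤ C) :
    ‖fderiv ℝ g x‖ ≤ n * (m * C) :=
  calc ‖fderiv ℝ g x‖ ≤ ∑ j, ‖fderiv ℝ g x (EuclideanSpace.single j 1)‖ := Vec.opNorm_le_sum _
    _ ≤ ∑ _ : Fin n, ∑ _ : Fin m, C := Finset.sum_le_sum fun j _ =>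
        (Vec.norm_le_sum _).trans (Finset.sum_le_sum fun i _ => by
          rw [fderiv_apply_coord hg]
          exact hC i j)
    _ = n * (m * C) := by simp

/-- Reassembles the derivative of `∇J` from those of its coordinates, which are computed separately.
-/
lemma hasFDerivAt_clm_of_coord {n : ℕ} {E : Type*} [NormedAddCommGroup E] [NormedSpace ℝ E]
    {g : E → Vec n →L[ℝ] ℝ} {L : Fin n → E →L[ℝ] ℝ} {x : E}
    (h : ∀ k, HasFDerivAt (fun y => g y (EuclideanSpace.single k 1)) (L k) x) :
    ∃ L' : E →L[ℝ] Vec n →L[ℝ] ℝ, HasFDerivAt g L' x ∧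
      ∀ v k, L' v (EuclideanSpace.single k 1) = L k v := by
  refine ⟨∑ k, (L k).smulRight (EuclideanSpace.proj k : Vec n →L[ℝ] ℝ), ?_, fun v k => ?_⟩
  · have heq : g = fun y => ∑ k, g y (EuclideanSpace.single k 1) •
        (EuclideanSpace.proj k : Vec n →L[ℝ] ℝ) := by
      funext y
      ext v
      rw [Vec.apply_eq_sum (g y) v]
      simp [mul_comm]
    rw [heq]
    exact HasFDerivAt.fun_sum fun k _ => (h k).smul_const (EuclideanSpace.proj k : Vec n →L[ℝ] ℝ)
  · simp

/-! ### Estimates of derivatives -/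

section

variable {E : Type*} [NormedAddCommGroup E] [NormedSpace ℝ E]

/-- The mean value inequality for `f - f' x` on the segment, where the derivative is at most `K * ‖y
- x‖`. -/
lemma abs_sub_sub_fderiv_le {f : E → ℝ} {f' : E → E →L[ℝ] ℝ} {s : Set E} (hs : Convex ℝ s)
    (hf : ∀ z ∈ s, HasFDerivAt f (f' z) z) {K : ℝ} (hK : 0 ≤ K)
    (hLip : ∀ z ∈ s, ∀ w ∈ s, ‖f' z - f' w‖ ≤ K * ‖z - w‖) {x y : E} (hx : x ∈ s) (hy : y ∈ s) :
    |f y - f x - f' x (y - x)| ≤ K * ‖y - x‖ ^ 2 := by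
  have hseg : segment ℝ x y ⊆ s := hs.segment_subset hx hy
  have h := (convex_segment x y).norm_image_sub_le_of_norm_hasFDerivWithin_le' (f := f)
    (f' := f') (φ := f' x) (C := K * ‖y - x‖)
    (fun z hz => (hf z (hseg hz)).hasFDerivWithinAt)
    (fun z hz => (hLip z (hseg hz) x hx).trans
      (mul_le_mul_of_nonneg_left (norm_sub_le_of_mem_segment hz) hK))
    (left_mem_segment ℝ x y) (right_mem_segment ℝ x y)
  rw [pow_two, ← mul_assoc]
  exact h

/-- A bound of a derivative by bounds of the function and of the second derivative. -/
lemma norm_fderiv_le_of_abs_le {f : E → ℝ} {f' : E → E →L[ℝ] ℝ} {s : Set E} (hs : Convex ℝ s)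
    (hf : ∀ z ∈ s, HasFDerivAt f (f' z) z) {K : ℝ} (hK : 0 ≤ K)
    (hLip : ∀ z ∈ s, ∀ w ∈ s, ‖f' z - f' w‖ ≤ K * ‖z - w‖) {m : ℝ}
    (hm : ∀ z ∈ s, |f z| ≤ m) {x : E} {t : ℝ} (ht : 0 < t) (hx : Metric.closedBall x t ⊆ s) :
    ‖f' x‖ ≤ 2 * m / t + K * t := by
  have hxs : x ∈ s := hx (Metric.mem_closedBall_self ht.le)
  have hm0 : 0 ≤ m := (abs_nonneg _).trans (hm x hxs)
  refine ContinuousLinearMap.opNorm_le_of_unit_norm (by positivity) fun v hv => ?_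
  have hnorm : ‖t • v‖ = t := by rw [norm_smul, hv, mul_one, Real.norm_of_nonneg ht.le]
  have hy : x + t • v ∈ s := hx (by simp [hnorm])
  -- Up to an error `K * t ^ 2`, `t * f' x v` is a difference of two values of `f`; dividing by `t`
  -- gives the claim.
  have h := abs_sub_sub_fderiv_le hs hf hK hLip hxs hy
  rw [add_sub_cancel_left, hnorm, map_smul, smul_eq_mul] at h
  have h1 : t * ‖f' x v‖ ≤ 2 * m + K * t ^ 2 := by
    rw [← Real.norm_of_nonneg ht.le, ← norm_mul, Real.norm_of_nonneg ht.le, Real.norm_eq_abs]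
    rw [abs_le] at h ⊢
    have h2 := abs_le.mp (hm _ hy)
    have h3 := abs_le.mp (hm x hxs)
    constructor <;> linarith
  have h2 : 2 * m / t + K * t = (2 * m + K * t ^ 2) / t := by field_simp
  rw [h2, le_div_iff₀ ht, mul_comm]
  exact h1

variable {Θ : Type*} [NormedAddCommGroup Θ]

/-- A bound of the change of a derivative with a parameter, by bounds of the change of the function
and of its second derivative. -/
lemma norm_fderiv_sub_fderiv_le {f g : E → ℝ} {s : Set E} (hs : Convex ℝ s)
    (hf : ∀ z ∈ s, DifferentiableAt ℝ f z) (hf' : ∀ z ∈ s, DifferentiableAt ℝ (fderiv ℝ f) z)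
    (hg : ∀ z ∈ s, DifferentiableAt ℝ g z) (hg' : ∀ z ∈ s, DifferentiableAt ℝ (fderiv ℝ g) z)
    {K : ℝ} (hK : 0 ≤ K)
    (hfg : ∀ z ∈ s, ‖fderiv ℝ (fderiv ℝ f) z - fderiv ℝ (fderiv ℝ g) z‖ ≤ K) {m : ℝ}
    (hm : ∀ z ∈ s, |f z - g z| ≤ m) {x : E} {t : ℝ} (ht : 0 < t)
    (hx : Metric.closedBall x t ⊆ s) :
    ‖fderiv ℝ f x - fderiv ℝ g x‖ ≤ 2 * m / t + K * t := by
  refine norm_fderiv_le_of_abs_le (f := fun z => f z - g z)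
    (f' := fun z => fderiv ℝ f z - fderiv ℝ g z) hs
    (fun z hz => (hf z hz).hasFDerivAt.sub (hg z hz).hasFDerivAt) hK (fun z hz w hw => ?_) hm ht hx
  exact hs.norm_image_sub_le_of_norm_hasFDerivWithin_le
    (fun z hz => ((hf' z hz).hasFDerivAt.sub (hg' z hz).hasFDerivAt).hasFDerivWithinAt) hfg hw hz

/-- Interpolation at the scale `t = ‖θ - θ₀‖`, with function difference `K * t ^ 2` and Hessian
difference `2 * K`, bounds the change of gradient from `q θ₀` to `q θ` by `4 * K * t`. Moving from
the critical point `p θ₀` to `p θ` adds `K ^ 2 * t`. The bound on `(K + 1) * t` keeps the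
interpolation ball inside the domain. -/
lemma norm_fderiv_apply_le_of_critical {q : Θ → E → ℝ} {p : Θ → E} {θ₀ θ : Θ} {r K : ℝ}
    (hK : 0 ≤ K)
    (hq : ∀ ϑ ∈ ({θ₀, θ} : Set Θ), ∀ a ∈ Metric.ball (p θ₀) r, DifferentiableAt ℝ (q ϑ) a)
    (hq' : ∀ ϑ ∈ ({θ₀, θ} : Set Θ), ∀ a ∈ Metric.ball (p θ₀) r,
      DifferentiableAt ℝ (fderiv ℝ (q ϑ)) a)
    (hqK : ∀ ϑ ∈ ({θ₀, θ} : Set Θ), ∀ a ∈ Metric.ball (p θ₀) r,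
      ‖fderiv ℝ (fderiv ℝ (q ϑ)) a‖ ≤ K)
    (hpK : ‖p θ - p θ₀‖ ≤ K * ‖θ - θ₀‖) (hcrit : fderiv ℝ (q θ₀) (p θ₀) = 0)
    (hdiff : ∀ a ∈ Metric.ball (p θ₀) r, |q θ a - q θ₀ a| ≤ K * ‖θ - θ₀‖ ^ 2)
    (hθ : (K + 1) * ‖θ - θ₀‖ < r) :
    ‖fderiv ℝ (q θ) (p θ)‖ ≤ (4 * K + K ^ 2) * ‖θ - θ₀‖ := by
  rcases eq_or_ne θ θ₀ with rfl | hne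
  · simp [hcrit]
  have hpos : 0 < ‖θ - θ₀‖ := norm_pos_iff.mpr (sub_ne_zero.mpr hne)
  have h0 : θ₀ ∈ ({θ₀, θ} : Set Θ) := by simp
  have h1 : θ ∈ ({θ₀, θ} : Set Θ) := by simp
  have hball : Metric.closedBall (p θ) ‖θ - θ₀‖ ⊆ Metric.ball (p θ₀) r := by
    refine Metric.closedBall_subset_ball' ?_
    rw [dist_eq_norm]
    linarith
  have hpθ : p θ ∈ Metric.ball (p θ₀) r := hball (Metric.mem_closedBall_self hpos.le)
  have hp₀ : p θ₀ ∈ Metric.ball (p θ₀) r :=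
    Metric.mem_ball_self (lt_of_le_of_lt (by positivity) hθ)
  have h2 := norm_fderiv_sub_fderiv_le (convex_ball (p θ₀) r) (hq θ h1) (hq' θ h1) (hq θ₀ h0)
    (hq' θ₀ h0) (K := 2 * K) (by positivity)
    (fun a ha => (norm_sub_le (fderiv ℝ (fderiv ℝ (q θ)) a)
      (fderiv ℝ (fderiv ℝ (q θ₀)) a)).trans
      ((add_le_add (hqK θ h1 a ha) (hqK θ₀ h0 a ha)).trans_eq (two_mul K).symm)) hdiff hpos
    hball
  have h3 := (convex_ball (p θ₀) r).norm_image_sub_le_of_norm_fderiv_le (hq' θ₀ h0) (hqK θ₀ h0)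
    hp₀ hpθ
  rw [hcrit, sub_zero] at h3
  have h4 : 2 * (K * ‖θ - θ₀‖ ^ 2) / ‖θ - θ₀‖ = 2 * K * ‖θ - θ₀‖ := by field_simp
  rw [h4] at h2
  have h5 := norm_sub_norm_le (fderiv ℝ (q θ) (p θ)) (fderiv ℝ (q θ₀) (p θ))
  have h6 : K * ‖p θ - p θ₀‖ ≤ K * (K * ‖θ - θ₀‖) := mul_le_mul_of_nonneg_left hpK hK
  linarith

/-- The derivative in `θ` of `∇q_θ(p_θ)`, at a parameter where it does not matter that `q_θ`
depends on `θ`, as this function changes with a square of the change in `θ` only. -/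
lemma hasFDerivAt_fderiv_apply_of_sq [NormedSpace ℝ Θ] {q : Θ → E → ℝ} {p : Θ → E} {θ₀ : Θ} {r K : ℝ}
    (hr : 0 < r) (hK : 0 ≤ K)
    (hq : ∀ᶠ θ in 𝓝 θ₀, ∀ a ∈ Metric.ball (p θ₀) r, DifferentiableAt ℝ (q θ) a)
    (hq' : ∀ᶠ θ in 𝓝 θ₀, ∀ a ∈ Metric.ball (p θ₀) r, DifferentiableAt ℝ (fderiv ℝ (q θ)) a)
    (hcont : ContinuousAt (fun x : Θ × E => fderiv ℝ (fderiv ℝ (q x.1)) x.2) (θ₀, p θ₀))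
    (hpK : ∀ᶠ θ in 𝓝 θ₀, ‖p θ - p θ₀‖ ≤ K * ‖θ - θ₀‖)
    (hdiff : ∀ᶠ θ in 𝓝 θ₀, ∀ a ∈ Metric.ball (p θ₀) r, |q θ a - q θ₀ a| ≤ K * ‖θ - θ₀‖ ^ 2)
    (hp : DifferentiableAt ℝ p θ₀) :
    HasFDerivAt (fun θ => fderiv ℝ (q θ) (p θ))
      (fderiv ℝ (fderiv ℝ (q θ₀)) (p θ₀) ∘L fderiv ℝ p θ₀) θ₀ := by
  have hfix : HasFDerivAt (fun θ => fderiv ℝ (q θ₀) (p θ))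
      (fderiv ℝ (fderiv ℝ (q θ₀)) (p θ₀) ∘L fderiv ℝ p θ₀) θ₀ :=
    (hq'.self_of_nhds _ (Metric.mem_ball_self hr)).hasFDerivAt.comp θ₀ hp.hasFDerivAt
  have hrest : HasFDerivAt (fun θ => fderiv ℝ (q θ) (p θ) - fderiv ℝ (q θ₀) (p θ))
      (0 : Θ →L[ℝ] E →L[ℝ] ℝ) θ₀ := by
    rw [hasFDerivAt_iff_isLittleO, Asymptotics.isLittleO_iff]
    intro η hη
    -- Interpolation takes place at scale `N * ‖θ - θ₀‖`. A large `N` makes the contribution of the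
    -- function values small, and then Hessians within `η / (2 * N)` of each other contribute the
    -- other `η / 2`.
    obtain ⟨N, hN0, hN⟩ : ∃ N : ℝ, 0 < N ∧ 2 * K / N ≤ η / 2 :=
      ⟨4 * K / η + 1, by positivity, by
        rw [div_le_iff₀ (by positivity)]
        have : η / 2 * (4 * K / η + 1) = 2 * K + η / 2 := by field_simp; ring
        linarith⟩
    -- Half of `η / (2 * N)`, since two Hessians are compared through the one at `(θ₀, p θ₀)`.
    have hε : 0 < η / (4 * N) := by positivity
    obtain ⟨ρ, hρ, hclose⟩ := Metric.continuousAt_iff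
      (f := fun x : Θ × E => fderiv ℝ (fderiv ℝ (q x.1)) x.2).mp hcont _ hε
    -- `p θ` is within `K * ‖θ - θ₀‖` of `p θ₀`, and the interpolation ball around it has radius `N
    -- * ‖θ - θ₀‖`.
    have hsmall : ∀ᶠ θ in 𝓝 θ₀, (K + N) * ‖θ - θ₀‖ < min ρ r := by
      have : ContinuousAt (fun θ => (K + N) * ‖θ - θ₀‖) θ₀ := by fun_prop
      exact this.eventually_lt continuousAt_const (by simp [hρ, hr])
    have hnear : ∀ᶠ θ in 𝓝 θ₀, dist θ θ₀ < ρ := Metric.ball_mem_nhds θ₀ hρ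
    filter_upwards [hq, hq', hpK, hdiff, hsmall, hnear] with θ h1 h2 h3 h4 h5 h6
    rcases eq_or_ne θ θ₀ with rfl | hne
    · simp
    have hpos : 0 < ‖θ - θ₀‖ := norm_pos_iff.mpr (sub_ne_zero.mpr hne)
    have hsub : Metric.ball (p θ₀) (min ρ r) ⊆ Metric.ball (p θ₀) r :=
      Metric.ball_subset_ball (min_le_right _ _)
    have hball : Metric.closedBall (p θ) (N * ‖θ - θ₀‖) ⊆ Metric.ball (p θ₀) (min ρ r) := by
      refine Metric.closedBall_subset_ball' ?_
      rw [dist_eq_norm]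
      linarith
    have hhess : ∀ a ∈ Metric.ball (p θ₀) (min ρ r),
        ‖fderiv ℝ (fderiv ℝ (q θ)) a - fderiv ℝ (fderiv ℝ (q θ₀)) a‖ ≤ η / (2 * N) := by
      intro a ha
      have haρ : dist a (p θ₀) < ρ := lt_of_lt_of_le ha (min_le_left _ _)
      have e1 := hclose (x := (θ, a)) (max_lt h6 haρ)
      have e2 := hclose (x := (θ₀, a)) (max_lt (by simpa using hρ) haρ)
      have e3 : η / (2 * N) = η / (4 * N) + η / (4 * N) := by field_simp; norm_num
      rw [e3]
      refine (dist_eq_norm (fderiv ℝ (fderiv ℝ (q θ)) a)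
        (fderiv ℝ (fderiv ℝ (q θ₀)) a)).symm.trans_le ?_
      exact (dist_triangle_right _ _ _).trans (add_le_add e1.le e2.le)
    have h0 := norm_fderiv_sub_fderiv_le (convex_ball (p θ₀) (min ρ r))
      (fun a ha => h1 a (hsub ha)) (fun a ha => h2 a (hsub ha))
      (fun a ha => hq.self_of_nhds a (hsub ha)) (fun a ha => hq'.self_of_nhds a (hsub ha))
      (by positivity) hhess (fun a ha => h4 a (hsub ha)) (mul_pos hN0 hpos) hball
    have e1 : 2 * (K * ‖θ - θ₀‖ ^ 2) / (N * ‖θ - θ₀‖) + η / (2 * N) * (N * ‖θ - θ₀‖) =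
        (2 * K / N + η / 2) * ‖θ - θ₀‖ := by field_simp
    rw [e1] at h0
    simp only [sub_self, _root_.zero_apply, sub_zero]
    refine h0.trans (mul_le_mul_of_nonneg_right ?_ (norm_nonneg _))
    linarith
  have h := hrest.add hfix
  rw [zero_add] at h
  refine h.congr_of_eventuallyEq (Eventually.of_forall fun θ => ?_)
  simp

end

namespace MDP

variable {S : Type*} [MeasurableSpace S] {na nθ : ℕ} {M : MDP S na}

/-! ### Measurability of derivatives -/

lemma measurable_grad_Q {p : S → Vec na} (hp : M.IsPolicy p) {b : S → Vec na} (hb : Measurable b)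
    (hd : ∀ s, DifferentiableAt ℝ (M.Q p s) (b s)) (i : Fin na) :
    Measurable fun s => grad (M.Q p s) (b s) i :=
  measurable_fderiv_apply _ (fun s => (hd s).hasFDerivAt)
    ((measurable_Q hp).comp (measurable_id.prodMk hb)) one_pos fun _ _ _ =>
      (measurable_Q hp).comp (measurable_id.prodMk (hb.add_const _))

lemma measurable_hess_Q {p : S → Vec na} (hp : M.IsPolicy p) {b : S → Vec na} (hb : Measurable b)
    {δ : ℝ} (hδ : 0 < δ) (hd : ∀ s, ∀ a ∈ Metric.ball (b s) δ, DifferentiableAt ℝ (M.Q p s) a)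
    (hd' : ∀ s, DifferentiableAt ℝ (fderiv ℝ (M.Q p s)) (b s)) (i j : Fin na) :
    Measurable fun s => hess (M.Q p s) (b s) i j := by
  -- A Hessian entry is the derivative of the `j`-th partial derivative in direction `i`, hence the
  -- `flip`.
  refine measurable_fderiv_apply (f := fun s a => grad (M.Q p s) a j)
    (f' := fun s => (fderiv ℝ (fderiv ℝ (M.Q p s)) (b s)).flip (EuclideanSpace.single j 1))
    (EuclideanSpace.single i 1) (fun s => ?_)
    (measurable_grad_Q hp hb (fun s => hd s _ (Metric.mem_ball_self hδ)) j) hδ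
    fun t ht htδ => measurable_grad_Q hp (hb.add_const _) (fun s => hd s _ ?_) j
  · exact (ContinuousLinearMap.apply ℝ ℝ (EuclideanSpace.single j (1 : ℝ))).hasFDerivAt.comp (b s)
      (hd' s).hasFDerivAt
  · simpa [norm_smul, abs_of_pos ht] using htδ

lemma measurable_jacobian_policy {pol : Vec nθ → S → Vec na} (hpol : ∀ θ, M.IsPolicy (pol θ))
    {θ : Vec nθ} (i : Fin na) (hd : ∀ s, DifferentiableAt ℝ (fun ϑ => pol ϑ s i) θ) (j : Fin nθ) :
    Measurable fun s => jacobian (fun ϑ => pol ϑ s) θ i j := by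
  have hm : ∀ ϑ, Measurable fun s => pol ϑ s i := fun ϑ =>
    (EuclideanSpace.proj i : Vec na →L[ℝ] ℝ).continuous.measurable.comp (hpol ϑ).1
  exact measurable_fderiv_apply (b := fun _ => θ) _ (fun s => (hd s).hasFDerivAt) (hm θ) one_pos
    fun _ _ _ => hm _

lemma measurable_jacobian₂_policy {pol : Vec nθ → S → Vec na} (hpol : ∀ θ, M.IsPolicy (pol θ))
    {θ : Vec nθ} (i : Fin na)
    (hd : ∀ᶠ ϑ in 𝓝 θ, ∀ s, DifferentiableAt ℝ (fun ϑ => pol ϑ s i) ϑ)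
    (hd' : ∀ s, DifferentiableAt ℝ (fderiv ℝ fun ϑ => pol ϑ s i) θ) (j k : Fin nθ) :
    Measurable fun s => jacobian₂ (fun ϑ => pol ϑ s) θ i j k := by
  obtain ⟨δ, hδ, hball⟩ := Metric.eventually_nhds_iff.mp hd
  refine measurable_fderiv_apply (f := fun s ϑ => jacobian (fun ϑ => pol ϑ s) ϑ i k)
    (f' := fun s =>
      (fderiv ℝ (fderiv ℝ fun ϑ => pol ϑ s i) θ).flip (EuclideanSpace.single k 1))
    (b := fun _ => θ) (EuclideanSpace.single j 1) (fun s => ?_)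
    (measurable_jacobian_policy hpol i hd.self_of_nhds k) hδ
    fun t ht htδ => measurable_jacobian_policy hpol i (hball ?_) k
  · exact (ContinuousLinearMap.apply ℝ ℝ (EuclideanSpace.single k (1 : ℝ))).hasFDerivAt.comp θ
      (hd' s).hasFDerivAt
  · simpa [norm_smul, abs_of_pos ht] using htδ

/-! ### Regular families of policies -/

/-- The policies are twice differentiable in the parameters in `W`, and their action-value functions
are twice differentiable in the actions in the balls of radius `r` around `c s`. All derivatives
are bounded by `K`. -/
structure RegularOn (M : MDP S na) (pol : Vec nθ → S → Vec na) (W : Set (Vec nθ))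
    (c : S → Vec na) (r K : ℝ) : Prop where
  isPolicy : ∀ θ, M.IsPolicy (pol θ)
  isOpen : IsOpen W
  convex : Convex ℝ W
  radius_pos : 0 < r
  bound_nonneg : 0 ≤ K
  ball_subset : ∀ s, Metric.ball (c s) r ⊆ M.actions
  mem_ball : ∀ θ ∈ W, ∀ s, pol θ s ∈ Metric.ball (c s) (r / 2)
  diff_pol : ∀ θ ∈ W, ∀ s i, DifferentiableAt ℝ (fun ϑ => pol ϑ s i) θ
  diff_fderiv_pol : ∀ θ ∈ W, ∀ s i, DifferentiableAt ℝ (fderiv ℝ fun ϑ => pol ϑ s i) θ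
  norm_fderiv_pol : ∀ θ ∈ W, ∀ s, ‖fderiv ℝ (fun ϑ => pol ϑ s) θ‖ ≤ K
  abs_jacobian₂ : ∀ θ ∈ W, ∀ s i j k, |jacobian₂ (fun ϑ => pol ϑ s) θ i j k| ≤ K
  diff_Q : ∀ θ ∈ W, ∀ s, ∀ a ∈ Metric.ball (c s) r, DifferentiableAt ℝ (M.Q (pol θ) s) a
  diff_fderiv_Q : ∀ θ ∈ W, ∀ s, ∀ a ∈ Metric.ball (c s) r,
    DifferentiableAt ℝ (fderiv ℝ (M.Q (pol θ) s)) a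
  norm_fderiv_Q : ∀ θ ∈ W, ∀ s, ‖fderiv ℝ (M.Q (pol θ) s) (pol θ s)‖ ≤ K
  norm_fderiv_fderiv_Q : ∀ θ ∈ W, ∀ s, ∀ a ∈ Metric.ball (c s) r,
    ‖fderiv ℝ (fderiv ℝ (M.Q (pol θ) s)) a‖ ≤ K

namespace RegularOn

variable {pol : Vec nθ → S → Vec na} {W : Set (Vec nθ)} {c : S → Vec na} {r K B : ℝ}
  (h : M.RegularOn pol W c r K)

include h

lemma mem_ball_radius {θ : Vec nθ} (hθ : θ ∈ W) (s : S) : pol θ s ∈ Metric.ball (c s) r :=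
  Metric.ball_subset_ball (by linarith [h.radius_pos]) (h.mem_ball θ hθ s)

lemma mem_interior {θ : Vec nθ} (hθ : θ ∈ W) (s : S) : pol θ s ∈ interior M.actions :=
  interior_maximal (h.ball_subset s) Metric.isOpen_ball (h.mem_ball_radius hθ s)

lemma differentiableAt_pol {θ : Vec nθ} (hθ : θ ∈ W) (s : S) :
    DifferentiableAt ℝ (fun ϑ => pol ϑ s) θ :=
  differentiableAt_euclidean.mpr fun i => h.diff_pol θ hθ s i

lemma norm_pol_sub_le {θ ϑ : Vec nθ} (hθ : θ ∈ W) (hϑ : ϑ ∈ W) (s : S) :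
    ‖pol ϑ s - pol θ s‖ ≤ K * ‖ϑ - θ‖ :=
  h.convex.norm_image_sub_le_of_norm_fderiv_le (f := fun ϑ => pol ϑ s)
    (fun _ hx => h.differentiableAt_pol hx s) (fun x hx => h.norm_fderiv_pol x hx s) hθ hϑ

lemma norm_fderiv_Q_sub_le {θ : Vec nθ} (hθ : θ ∈ W) (s : S) {a b : Vec na}
    (ha : a ∈ Metric.ball (c s) r) (hb : b ∈ Metric.ball (c s) r) :
    ‖fderiv ℝ (M.Q (pol θ) s) b - fderiv ℝ (M.Q (pol θ) s) a‖ ≤ K * ‖b - a‖ :=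
  (convex_ball (c s) r).norm_image_sub_le_of_norm_fderiv_le (h.diff_fderiv_Q θ hθ s)
    (h.norm_fderiv_fderiv_Q θ hθ s) ha hb

/-- The gradient is bounded by assumption only at `pol θ s`. The Hessian bound extends this to the
ball, whose points are at distance at most `2 * r` from there. -/
lemma abs_Q_sub_le {θ : Vec nθ} (hθ : θ ∈ W) (s : S) {a b : Vec na}
    (ha : a ∈ Metric.ball (c s) r) (hb : b ∈ Metric.ball (c s) r) :
    |M.Q (pol θ) s b - M.Q (pol θ) s a| ≤ (K + K * (2 * r)) * ‖b - a‖ := by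
  refine (convex_ball (c s) r).norm_image_sub_le_of_norm_fderiv_le (h.diff_Q θ hθ s)
    (fun x hx => ?_) ha hb
  have h1 := h.norm_fderiv_Q_sub_le hθ s (h.mem_ball_radius hθ s) hx
  have h2 := norm_sub_norm_le (fderiv ℝ (M.Q (pol θ) s) x) (fderiv ℝ (M.Q (pol θ) s) (pol θ s))
  have h3 : ‖x - pol θ s‖ ≤ 2 * r := by
    have h4 := dist_triangle_right x (pol θ s) (c s)
    have h5 := Metric.mem_ball.mp (h.mem_ball_radius hθ s)
    have h6 := Metric.mem_ball.mp hx
    rw [dist_eq_norm] at h4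
    linarith
  have h7 := mul_le_mul_of_nonneg_left h3 h.bound_nonneg
  linarith [h.norm_fderiv_Q θ hθ s]

lemma measurable_grad {θ : Vec nθ} (hθ : θ ∈ W) (i : Fin na) :
    Measurable fun s => grad (M.Q (pol θ) s) (pol θ s) i :=
  measurable_grad_Q (h.isPolicy θ) (h.isPolicy θ).1
    (fun s => h.diff_Q θ hθ s _ (h.mem_ball_radius hθ s)) i

/-- Difference quotients of the gradient need a uniform ball around `pol θ s`; this is why
`mem_ball` asks for radius `r / 2`. -/
lemma measurable_hess {θ : Vec nθ} (hθ : θ ∈ W) (i j : Fin na) :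
    Measurable fun s => hess (M.Q (pol θ) s) (pol θ s) i j :=
  measurable_hess_Q (h.isPolicy θ) (h.isPolicy θ).1 (half_pos h.radius_pos)
    (fun s a ha => h.diff_Q θ hθ s a (by
      have h1 := Metric.mem_ball.mp (h.mem_ball θ hθ s)
      have h2 := Metric.mem_ball.mp ha
      have h3 := dist_triangle a (pol θ s) (c s)
      rw [Metric.mem_ball]
      linarith))
    (fun s => h.diff_fderiv_Q θ hθ s _ (h.mem_ball_radius hθ s)) i j

lemma measurable_jacobian {θ : Vec nθ} (hθ : θ ∈ W) (i : Fin na) (j : Fin nθ) :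
    Measurable fun s => jacobian (fun ϑ => pol ϑ s) θ i j :=
  measurable_jacobian_policy h.isPolicy i (fun s => h.diff_pol θ hθ s i) j

lemma measurable_jacobian₂ {θ : Vec nθ} (hθ : θ ∈ W) (i : Fin na) (j k : Fin nθ) :
    Measurable fun s => jacobian₂ (fun ϑ => pol ϑ s) θ i j k :=
  measurable_jacobian₂_policy h.isPolicy i
    ((h.isOpen.eventually_mem hθ).mono fun ϑ hϑ s => h.diff_pol ϑ hϑ s i)
    (fun s => h.diff_fderiv_pol θ hθ s i) j k

lemma fderiv_pol_apply {θ : Vec nθ} (hθ : θ ∈ W) (s : S) (i : Fin na) (j : Fin nθ) :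
    fderiv ℝ (fun ϑ => pol ϑ s) θ (EuclideanSpace.single j 1) i =
      jacobian (fun ϑ => pol ϑ s) θ i j :=
  fderiv_apply_coord (h.differentiableAt_pol hθ s) _ i

lemma norm_fderiv_pol_single {θ : Vec nθ} (hθ : θ ∈ W) (s : S) (j : Fin nθ) :
    ‖fderiv ℝ (fun ϑ => pol ϑ s) θ (EuclideanSpace.single j 1)‖ ≤ K := by
  simpa using (fderiv ℝ (fun ϑ => pol ϑ s) θ).le_of_opNorm_le (h.norm_fderiv_pol θ hθ s)
    (EuclideanSpace.single j 1)

lemma abs_jacobian {θ : Vec nθ} (hθ : θ ∈ W) (s : S) (i : Fin na) (j : Fin nθ) :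
    |jacobian (fun ϑ => pol ϑ s) θ i j| ≤ K := by
  rw [← h.fderiv_pol_apply hθ]
  exact (Vec.abs_apply_le _ i).trans (h.norm_fderiv_pol_single hθ s j)

lemma abs_hess {θ : Vec nθ} (hθ : θ ∈ W) (s : S) (i j : Fin na) :
    |hess (M.Q (pol θ) s) (pol θ s) i j| ≤ K := by
  have h1 := (fderiv ℝ (fderiv ℝ (M.Q (pol θ) s)) (pol θ s)).le_opNorm₂
    (EuclideanSpace.single i 1) (EuclideanSpace.single j 1)
  simp only [PiLp.norm_single, norm_one, mul_one] at h1
  exact h1.trans (h.norm_fderiv_fderiv_Q θ hθ s _ (h.mem_ball_radius hθ s))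

/-! ### The integrands -/

omit h in
lemma integrand₁_apply (θ : Vec nθ) (s : S) (j k : Fin nθ) :
    M.integrand₁ pol θ s j k = ∑ i, grad (M.Q (pol θ) s) (pol θ s) i *
      jacobian₂ (fun ϑ => pol ϑ s) θ i j k := by
  simp [integrand₁, tensorVec, Matrix.sum_apply]

omit h in
lemma integrand₂_apply (θ : Vec nθ) (s : S) (j k : Fin nθ) :
    M.integrand₂ pol θ s j k = ∑ i, (∑ l, jacobian (fun ϑ => pol ϑ s) θ l j *
      hess (M.Q (pol θ) s) (pol θ s) l i) * jacobian (fun ϑ => pol ϑ s) θ i k := by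
  simp [integrand₂, Matrix.mul_apply]

lemma measurable_integrand₁ {θ : Vec nθ} (hθ : θ ∈ W) (j k : Fin nθ) :
    Measurable fun s => M.integrand₁ pol θ s j k := by
  simp_rw [integrand₁_apply]
  exact Finset.measurable_fun_sum _ fun i _ =>
    (h.measurable_grad hθ i).mul (h.measurable_jacobian₂ hθ i j k)

lemma measurable_integrand₂ {θ : Vec nθ} (hθ : θ ∈ W) (j k : Fin nθ) :
    Measurable fun s => M.integrand₂ pol θ s j k := by
  simp_rw [integrand₂_apply]
  exact Finset.measurable_fun_sum _ fun i _ =>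
    (Finset.measurable_fun_sum _ fun l _ =>
      (h.measurable_jacobian hθ l j).mul (h.measurable_hess hθ l i)).mul
        (h.measurable_jacobian hθ i k)

/-- The bound `C` is kept apart from `K`, so that it can be taken proportional to `‖θ - θ₀‖`. -/
lemma abs_integrand₁_le {θ : Vec nθ} (hθ : θ ∈ W) (s : S) (j k : Fin nθ) {C : ℝ}
    (hC : ‖fderiv ℝ (M.Q (pol θ) s) (pol θ s)‖ ≤ C) :
    |M.integrand₁ pol θ s j k| ≤ na * (C * K) := by
  have hC0 : 0 ≤ C := (norm_nonneg _).trans hC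
  rw [integrand₁_apply]
  refine (Finset.abs_sum_le_sum_abs _ _).trans ?_
  calc _ ≤ ∑ _ : Fin na, C * K := Finset.sum_le_sum fun i _ => by
        rw [abs_mul]
        refine mul_le_mul ?_ (h.abs_jacobian₂ θ hθ s i j k) (abs_nonneg _) hC0
        change ‖fderiv ℝ (M.Q (pol θ) s) (pol θ s) (EuclideanSpace.single i 1)‖ ≤ C
        simpa using (fderiv ℝ (M.Q (pol θ) s) (pol θ s)).le_of_opNorm_le hC
          (EuclideanSpace.single i 1)
    _ = na * (C * K) := by simp

lemma abs_integrand₂_le {θ : Vec nθ} (hθ : θ ∈ W) (s : S) (j k : Fin nθ) :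
    |M.integrand₂ pol θ s j k| ≤ na * (na * (K * K) * K) := by
  have hK := h.bound_nonneg
  rw [integrand₂_apply]
  refine (Finset.abs_sum_le_sum_abs _ _).trans ?_
  calc _ ≤ ∑ _ : Fin na, na * (K * K) * K := Finset.sum_le_sum fun i _ => by
        rw [abs_mul]
        refine mul_le_mul ?_ (h.abs_jacobian hθ s i k) (abs_nonneg _) (by positivity)
        refine (Finset.abs_sum_le_sum_abs _ _).trans ?_
        calc _ ≤ ∑ _ : Fin na, K * K := Finset.sum_le_sum fun l _ => by
              rw [abs_mul]
              exact mul_le_mul (h.abs_jacobian hθ s l j) (h.abs_hess hθ s l i) (abs_nonneg _) hK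
          _ = na * (K * K) := by simp
    _ = na * (na * (K * K) * K) := by simp

lemma integrand₂_eq {θ : Vec nθ} (hθ : θ ∈ W) (s : S) (j k : Fin nθ) :
    M.integrand₂ pol θ s j k = fderiv ℝ (fderiv ℝ (M.Q (pol θ) s)) (pol θ s)
      (fderiv ℝ (fun ϑ => pol ϑ s) θ (EuclideanSpace.single j 1))
      (fderiv ℝ (fun ϑ => pol ϑ s) θ (EuclideanSpace.single k 1)) := by
  rw [integrand₂_apply, Vec.apply_eq_sum _ (fderiv ℝ (fun ϑ => pol ϑ s) θ
    (EuclideanSpace.single k 1))]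
  refine Finset.sum_congr rfl fun i _ => ?_
  rw [h.fderiv_pol_apply hθ, Vec.apply_eq_sum (fderiv ℝ (fderiv ℝ (M.Q (pol θ) s)) (pol θ s)),
    smul_eq_mul, mul_comm]
  congr 1
  simp only [_root_.sum_apply, _root_.smul_apply, h.fderiv_pol_apply hθ]
  rfl

/-- The integrand of the policy gradient is measurable. -/
lemma measurable_policyGradient {θ : Vec nθ} (hθ : θ ∈ W) (k : Fin nθ) :
    Measurable fun s => fderiv ℝ (M.Q (pol θ) s) (pol θ s)
      (fderiv ℝ (fun ϑ => pol ϑ s) θ (EuclideanSpace.single k 1)) := by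
  have heq : ∀ s, fderiv ℝ (M.Q (pol θ) s) (pol θ s)
      (fderiv ℝ (fun ϑ => pol ϑ s) θ (EuclideanSpace.single k 1)) =
      ∑ i, jacobian (fun ϑ => pol ϑ s) θ i k * grad (M.Q (pol θ) s) (pol θ s) i := fun s => by
    rw [Vec.apply_eq_sum]
    simp_rw [h.fderiv_pol_apply hθ]
    rfl
  simp_rw [heq]
  exact Finset.measurable_fun_sum _ fun i _ =>
    (h.measurable_jacobian hθ i k).mul (h.measurable_grad hθ i)

/-! ### The policy gradient theorem -/

/-- By the performance difference lemma, `J(ϑ) - J(θ)` is a discounted sum of advantages with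
respect to the fixed function `Q^{π_θ}`. The advantages vanish at `ϑ = θ` and are Lipschitz there,
so only the dependence on the action is differentiated. -/
lemma exists_hasFDerivAt_J (hγ : M.discount < 1)
    (hR : ∀ s, ∀ a ∈ M.actions, |M.reward s a| ≤ B)
    (hp : ∀ s s', ContinuousOn (fun a => M.trans s a s') (interior M.actions))
    {θ : Vec nθ} (hθ : θ ∈ W) :
    ∃ L : Vec nθ →L[ℝ] ℝ, HasFDerivAt (fun ϑ => M.J (pol ϑ)) L θ ∧
      ∀ k, L (EuclideanSpace.single k 1) = M.discountedSum (pol θ) M.init fun s =>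
        fderiv ℝ (M.Q (pol θ) s) (pol θ s)
          (fderiv ℝ (fun ϑ => pol ϑ s) θ (EuclideanSpace.single k 1)) := by
  have := M.init_prob
  have hK := h.bound_nonneg
  have hr := h.radius_pos
  have hW : ∀ᶠ ϑ in 𝓝 θ, ϑ ∈ W := h.isOpen.eventually_mem hθ
  have hQm : ∀ ϑ, Measurable fun s => M.Q (pol θ) s (pol ϑ s) := fun ϑ =>
    (measurable_Q (h.isPolicy θ)).comp (measurable_id.prodMk (h.isPolicy ϑ).1)
  obtain ⟨L, hL, hLk⟩ := exists_hasFDerivAt_discountedSum hγ hp h.isPolicy (h.mem_interior hθ)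
    (fun s => (h.differentiableAt_pol hθ s).continuousAt) M.init
    (Φ := fun ϑ s => M.Q (pol θ) s (pol ϑ s) - M.Q (pol θ) s (pol θ s))
    (Φ' := fun s => fderiv ℝ (M.Q (pol θ) s) (pol θ s) ∘L fderiv ℝ (fun ϑ => pol ϑ s) θ)
    (K := (K + K * (2 * r)) * K) (by positivity)
    (Eventually.of_forall fun ϑ => (hQm ϑ).sub (hQm θ))
    (hW.mono fun ϑ hϑ s => by
      refine (h.abs_Q_sub_le hθ s (h.mem_ball_radius hθ s) (h.mem_ball_radius hϑ s)).trans ?_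
      rw [mul_assoc _ K]
      exact mul_le_mul_of_nonneg_left (h.norm_pol_sub_le hθ hϑ s) (by positivity))
    (fun s => ((h.diff_Q θ hθ s _ (h.mem_ball_radius hθ s)).hasFDerivAt.comp θ
      (h.differentiableAt_pol hθ s).hasFDerivAt).sub_const _)
  refine ⟨L, (hL.add_const (M.J (pol θ))).congr_of_eventuallyEq
    (Eventually.of_forall fun ϑ => ?_), hLk⟩
  have hJ := J_sub_J hγ hR (h.isPolicy θ) (h.isPolicy ϑ)
  simp only [← hJ, sub_add_cancel]

end RegularOn

end MDP

namespace MDP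

variable {S : Type*} [MeasurableSpace S] {na nθ : ℕ} {M : MDP S na}

namespace RegularOn

variable {pol : Vec nθ → S → Vec na} {W : Set (Vec nθ)} {r K B : ℝ} {θ₀ : Vec nθ}

/-! ### Behaviour at a critical parameter -/

section

variable (h : M.RegularOn pol W (pol θ₀) r K) (hθ₀ : θ₀ ∈ W)
  (hcrit : ∀ s, fderiv ℝ (M.Q (pol θ₀) s) (pol θ₀ s) = 0) (hγ : M.discount < 1)
  (hR : ∀ s, ∀ a ∈ M.actions, |M.reward s a| ≤ B)

include h hθ₀ hcrit hγ hR

/-- At a critical point the advantage is a Taylor remainder of second order, at most `K * (K * ‖θ -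
θ₀‖) ^ 2`. -/
lemma abs_V_sub_V_le {θ : Vec nθ} (hθ : θ ∈ W) (s : S) :
    |M.V (pol θ) s - M.V (pol θ₀) s| ≤ (1 - M.discount)⁻¹ * K ^ 3 * ‖θ - θ₀‖ ^ 2 := by
  rw [V_sub_V hγ hR (h.isPolicy θ₀) (h.isPolicy θ), mul_assoc]
  refine abs_discountedSum_le hγ (h.isPolicy θ) _ fun x => ?_
  have h1 := abs_sub_sub_fderiv_le (convex_ball (pol θ₀ x) r)
    (fun a ha => (h.diff_Q θ₀ hθ₀ x a ha).hasFDerivAt) h.bound_nonneg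
    (fun a ha b hb => h.norm_fderiv_Q_sub_le hθ₀ x hb ha) (h.mem_ball_radius hθ₀ x)
    (h.mem_ball_radius hθ x)
  rw [hcrit, _root_.zero_apply, sub_zero] at h1
  refine h1.trans ?_
  have h2 := pow_le_pow_left₀ (norm_nonneg _) (h.norm_pol_sub_le hθ₀ hθ x) 2
  calc K * ‖pol θ x - pol θ₀ x‖ ^ 2 ≤ K * (K * ‖θ - θ₀‖) ^ 2 :=
        mul_le_mul_of_nonneg_left h2 h.bound_nonneg
    _ = K ^ 3 * ‖θ - θ₀‖ ^ 2 := by ring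

lemma abs_Q_sub_Q_le_sq {θ : Vec nθ} (hθ : θ ∈ W) (s : S) {a : Vec na}
    (ha : a ∈ Metric.ball (pol θ₀ s) r) :
    |M.Q (pol θ) s a - M.Q (pol θ₀) s a| ≤
      (K + (1 - M.discount)⁻¹ * K ^ 3) * ‖θ - θ₀‖ ^ 2 := by
  refine (abs_Q_sub_Q_le hγ hR (h.isPolicy θ₀) (h.isPolicy θ)
    (h.abs_V_sub_V_le hθ₀ hcrit hγ hR hθ) s (h.ball_subset s ha)).trans ?_
  -- The summand `K` is slack: it lets a single constant serve here and as a bound for the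
  -- derivatives.
  have := mul_nonneg h.bound_nonneg (sq_nonneg ‖θ - θ₀‖)
  linarith

lemma eventually_norm_fderiv_Q_le : ∃ C : ℝ, 0 ≤ C ∧ ∀ᶠ θ in 𝓝 θ₀, ∀ s,
    ‖fderiv ℝ (M.Q (pol θ) s) (pol θ s)‖ ≤ C * ‖θ - θ₀‖ := by
  have hK := h.bound_nonneg
  have hC : 0 ≤ (1 - M.discount)⁻¹ * K ^ 3 :=
    mul_nonneg (inv_nonneg.mpr (by linarith)) (by positivity)
  set K' := K + (1 - M.discount)⁻¹ * K ^ 3 with hK'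
  have hKK' : K ≤ K' := by linarith
  have hsmall : ∀ᶠ θ in 𝓝 θ₀, (K' + 1) * ‖θ - θ₀‖ < r := by
    have : ContinuousAt (fun θ => (K' + 1) * ‖θ - θ₀‖) θ₀ := by fun_prop
    exact this.eventually_lt continuousAt_const (by simp [h.radius_pos])
  refine ⟨4 * K' + K' ^ 2, by positivity, ?_⟩
  filter_upwards [hsmall, h.isOpen.eventually_mem hθ₀] with θ hθr hθ s
  have hmem : ∀ ϑ ∈ ({θ₀, θ} : Set (Vec nθ)), ϑ ∈ W := by simp [hθ₀, hθ]
  exact norm_fderiv_apply_le_of_critical (q := fun ϑ => M.Q (pol ϑ) s) (p := fun ϑ => pol ϑ s)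
    (hK.trans hKK') (fun ϑ hϑ => h.diff_Q ϑ (hmem ϑ hϑ) s)
    (fun ϑ hϑ => h.diff_fderiv_Q ϑ (hmem ϑ hϑ) s)
    (fun ϑ hϑ a ha => (h.norm_fderiv_fderiv_Q ϑ (hmem ϑ hϑ) s a ha).trans hKK')
    ((h.norm_pol_sub_le hθ₀ hθ s).trans (mul_le_mul_of_nonneg_right hKK' (norm_nonneg _)))
    (hcrit s) (fun a ha => h.abs_Q_sub_Q_le_sq hθ₀ hcrit hγ hR hθ s ha) hθr

lemma hasFDerivAt_fderiv_Q {s : S}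
    (hcont : ContinuousAt (fun x : Vec nθ × Vec na => hess (M.Q (pol x.1) s) x.2)
      (θ₀, pol θ₀ s)) :
    HasFDerivAt (fun θ => fderiv ℝ (M.Q (pol θ) s) (pol θ s))
      (fderiv ℝ (fderiv ℝ (M.Q (pol θ₀) s)) (pol θ₀ s) ∘L fderiv ℝ (fun ϑ => pol ϑ s) θ₀) θ₀ := by
  have hK := h.bound_nonneg
  have hC : 0 ≤ (1 - M.discount)⁻¹ * K ^ 3 :=
    mul_nonneg (inv_nonneg.mpr (by linarith)) (by positivity)
  have hW := h.isOpen.eventually_mem hθ₀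
  refine hasFDerivAt_fderiv_apply_of_sq (q := fun ϑ => M.Q (pol ϑ) s) (p := fun ϑ => pol ϑ s)
    (K := K + (1 - M.discount)⁻¹ * K ^ 3) h.radius_pos (by linarith)
    (hW.mono fun θ hθ => h.diff_Q θ hθ s) (hW.mono fun θ hθ => h.diff_fderiv_Q θ hθ s) ?_
    (hW.mono fun θ hθ => (h.norm_pol_sub_le hθ₀ hθ s).trans
      (mul_le_mul_of_nonneg_right (by linarith) (norm_nonneg _)))
    (hW.mono fun θ hθ a ha => h.abs_Q_sub_Q_le_sq hθ₀ hcrit hγ hR hθ s ha)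
    (h.differentiableAt_pol hθ₀ s)
  -- Continuity is given for the matrix entries and is needed for the operator norm.
  have hentry : ∀ i j, Tendsto (fun x : Vec nθ × Vec na =>
      |hess (M.Q (pol x.1) s) x.2 i j - hess (M.Q (pol θ₀) s) (pol θ₀ s) i j|)
      (𝓝 (θ₀, pol θ₀ s)) (𝓝 0) := fun i j => by
    have h1 := tendsto_pi_nhds.mp (tendsto_pi_nhds.mp hcont.tendsto i) j
    simpa using (h1.sub_const (hess (M.Q (pol θ₀) s) (pol θ₀ s) i j)).abs
  have hsum : Tendsto (fun x : Vec nθ × Vec na => ∑ i, ∑ j,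
      |hess (M.Q (pol x.1) s) x.2 i j - hess (M.Q (pol θ₀) s) (pol θ₀ s) i j|)
      (𝓝 (θ₀, pol θ₀ s)) (𝓝 0) := by
    simpa using tendsto_finsetSum Finset.univ fun i _ =>
      tendsto_finsetSum Finset.univ fun j _ => hentry i j
  refine (tendsto_iff_norm_sub_tendsto_zero (E := Vec na →L[ℝ] Vec na →L[ℝ] ℝ)).mpr ?_
  exact squeeze_zero (fun _ => by positivity) (fun x => norm_fderiv_fderiv_sub_le
    (M.Q (pol x.1) s) (M.Q (pol θ₀) s) x.2 (pol θ₀ s)) hsum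

variable (hp : ∀ s s', ContinuousOn (fun a => M.trans s a s') (interior M.actions))
  (hcont : ∀ s, ContinuousAt (fun x : Vec nθ × Vec na => hess (M.Q (pol x.1) s) x.2)
    (θ₀, pol θ₀ s))

include hp hcont

/-- At a critical parameter the Gauss-Newton matrix is the Hessian of the performance. -/
theorem twiceDifferentiableAt_J_and_M₂_eq :
    TwiceDifferentiableAt (fun θ => M.J (pol θ)) θ₀ ∧
      M.M₂ pol θ₀ = hess (fun θ => M.J (pol θ)) θ₀ := by
  have := M.init_prob
  have hK := h.bound_nonneg
  have hW := h.isOpen.eventually_mem hθ₀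
  obtain ⟨C, hC, hCQ⟩ := h.eventually_norm_fderiv_Q_le hθ₀ hcrit hγ hR
  have hcoord : ∀ k, ∃ L : Vec nθ →L[ℝ] ℝ,
      HasFDerivAt (fun θ => fderiv ℝ (fun ϑ => M.J (pol ϑ)) θ (EuclideanSpace.single k 1)) L θ₀ ∧
      ∀ j, L (EuclideanSpace.single j 1) =
        M.discountedSum (pol θ₀) M.init fun s => M.integrand₂ pol θ₀ s j k := by
    intro k
    let x : Vec nθ → S → Vec na := fun θ s =>
      fderiv ℝ (fun ϑ => pol ϑ s) θ (EuclideanSpace.single k 1)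
    have hx : ∀ s, DifferentiableAt ℝ (fun θ => x θ s) θ₀ := fun s => by
      refine differentiableAt_euclidean.mpr fun i => ?_
      have h1 : DifferentiableAt ℝ (fun θ => fderiv ℝ (fun ϑ => pol ϑ s i) θ
          (EuclideanSpace.single k 1)) θ₀ :=
        (h.diff_fderiv_pol θ₀ hθ₀ s i).clm_apply (differentiableAt_const _)
      refine h1.congr_of_eventuallyEq (hW.mono fun θ hθ => ?_)
      exact h.fderiv_pol_apply hθ s i k
    -- The summand is the integrand of the policy gradient, which criticality makes vanish at `θ₀`
    -- and grow at most linearly, uniformly in `s`.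
    obtain ⟨L, hL, hLj⟩ := exists_hasFDerivAt_discountedSum hγ hp h.isPolicy
      (h.mem_interior hθ₀) (fun s => (h.differentiableAt_pol hθ₀ s).continuousAt) M.init
      (Φ := fun θ s => fderiv ℝ (M.Q (pol θ) s) (pol θ s) (x θ s)) (K := C * K) (by positivity)
      (hW.mono fun θ hθ => h.measurable_policyGradient hθ k)
      (by
        filter_upwards [hW, hCQ] with θ hθ hθQ s
        refine ((fderiv ℝ (M.Q (pol θ) s) (pol θ s)).le_of_opNorm_le_of_le (hθQ s)
          (h.norm_fderiv_pol_single hθ s k)).trans_eq ?_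
        ring)
      (fun s => (h.hasFDerivAt_fderiv_Q hθ₀ hcrit hγ hR (hcont s)).clm_apply (hx s).hasFDerivAt)
    refine ⟨L, hL.congr_of_eventuallyEq (hW.mono fun θ hθ => ?_), fun j => (hLj j).trans ?_⟩
    · obtain ⟨L', hL', hLk'⟩ := h.exists_hasFDerivAt_J hγ hR hp hθ
      change fderiv ℝ (fun ϑ => M.J (pol ϑ)) θ (EuclideanSpace.single k 1) = _
      rw [hL'.fderiv, hLk']
    · congr 1
      funext s
      -- Of the product rule only the term with `∇ₐ²Q` survives; the one with `∇²π` carries the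
      -- factor `∇ₐQ = 0`.
      rw [h.integrand₂_eq hθ₀, hcrit]
      simp [x]
  choose L hL hLj using hcoord
  obtain ⟨L', hL', hLk'⟩ := hasFDerivAt_clm_of_coord hL
  refine ⟨⟨hW.mono fun θ hθ => ?_, hL'.differentiableAt⟩, ?_⟩
  · obtain ⟨_, hJ, _⟩ := h.exists_hasFDerivAt_J hγ hR hp hθ
    exact hJ.differentiableAt
  · ext j k
    simp only [M₂, hess, Matrix.of_apply]
    rw [hL'.fderiv, hLk', hLj, integral_occupancy hγ (h.isPolicy θ₀)
      (h.measurable_integrand₂ hθ₀ j k) fun s => h.abs_integrand₂_le hθ₀ s j k]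

omit hp hcont in
theorem tendsto_M₁ : Tendsto (M.M₁ pol) (𝓝 θ₀) (𝓝 0) := by
  have := M.init_prob
  have hK := h.bound_nonneg
  have hW := h.isOpen.eventually_mem hθ₀
  obtain ⟨C, hC, hCQ⟩ := h.eventually_norm_fderiv_Q_le hθ₀ hcrit hγ hR
  refine tendsto_pi_nhds.mpr fun j => tendsto_pi_nhds.mpr fun k => ?_
  have hlim : Tendsto (fun θ => (1 - M.discount)⁻¹ * (na * (C * ‖θ - θ₀‖ * K))) (𝓝 θ₀)
      (𝓝 0) := by
    have : Continuous fun θ => (1 - M.discount)⁻¹ * (na * (C * ‖θ - θ₀‖ * K)) := by fun_prop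
    simpa using this.tendsto θ₀
  refine squeeze_zero_norm' ?_ hlim
  filter_upwards [hW, hCQ] with θ hθ hθQ
  have hle : ∀ s, |M.integrand₁ pol θ s j k| ≤ na * (C * ‖θ - θ₀‖ * K) := fun s =>
    h.abs_integrand₁_le hθ s j k (hθQ s)
  rw [M₁, Matrix.of_apply, integral_occupancy hγ (h.isPolicy θ) (h.measurable_integrand₁ hθ j k)
    hle]
  exact abs_discountedSum_le hγ (h.isPolicy θ) _ hle

omit hcrit hR in
-- Integrand and state distribution both vary with `θ`. The integrands converge pointwise under a
-- uniform bound, and the closed loop depends continuously on the policy.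
theorem tendsto_M₂ : Tendsto (M.M₂ pol) (𝓝 θ₀) (𝓝 (M.M₂ pol θ₀)) := by
  have := M.init_prob
  have hW := h.isOpen.eventually_mem hθ₀
  have hpolc : ∀ s, ContinuousAt (fun θ => pol θ s) θ₀ := fun s =>
    (h.differentiableAt_pol hθ₀ s).continuousAt
  refine tendsto_pi_nhds.mpr fun j => tendsto_pi_nhds.mpr fun k => ?_
  have hjac : ∀ s i j, Tendsto (fun θ => jacobian (fun ϑ => pol ϑ s) θ i j) (𝓝 θ₀)
      (𝓝 (jacobian (fun ϑ => pol ϑ s) θ₀ i j)) := fun s i j =>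
    ((h.diff_fderiv_pol θ₀ hθ₀ s i).clm_apply (differentiableAt_const _)).continuousAt
  have hhess : ∀ s i j, Tendsto (fun θ => hess (M.Q (pol θ) s) (pol θ s) i j) (𝓝 θ₀)
      (𝓝 (hess (M.Q (pol θ₀) s) (pol θ₀ s) i j)) := fun s i j => by
    have h1 : Tendsto (fun θ => (θ, pol θ s)) (𝓝 θ₀) (𝓝 (θ₀, pol θ₀ s)) :=
      continuousAt_id.prodMk (hpolc s)
    exact tendsto_pi_nhds.mp (tendsto_pi_nhds.mp ((hcont s).tendsto.comp h1) i) j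
  have hlim := tendsto_discountedSum hγ hp h.isPolicy (h.isPolicy θ₀) (h.mem_interior hθ₀) hpolc
    M.init (f := fun θ s => M.integrand₂ pol θ s j k)
    (f₀ := fun s => M.integrand₂ pol θ₀ s j k)
    (hW.mono fun θ hθ => h.measurable_integrand₂ hθ j k) (h.measurable_integrand₂ hθ₀ j k)
    (hW.mono fun θ hθ s => h.abs_integrand₂_le hθ s j k)
    (fun s => h.abs_integrand₂_le hθ₀ s j k) fun s => by
      simp_rw [integrand₂_apply]
      exact tendsto_finsetSum _ fun i _ => (tendsto_finsetSum _ fun l _ =>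
        (hjac s l j).mul (hhess s l i)).mul (hjac s i k)
  have heq : ∀ θ ∈ W, M.M₂ pol θ j k =
      M.discountedSum (pol θ) M.init fun s => M.integrand₂ pol θ s j k := fun θ hθ =>
    integral_occupancy hγ (h.isPolicy θ) (h.measurable_integrand₂ hθ j k)
      fun s => h.abs_integrand₂_le hθ s j k
  rw [heq θ₀ hθ₀]
  exact hlim.congr' (hW.mono fun θ hθ => (heq θ hθ).symm)

end

end RegularOn

/-! ### Regularity from bounds in coordinates -/

lemma exists_regularOn {pol : Vec nθ → S → Vec na} (hpol : ∀ θ, M.IsPolicy (pol θ))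
    {θ₀ : Vec nθ} {U : Set (Vec nθ)} (hU : U ∈ 𝓝 θ₀)
    (hpol_diff : ∀ θ ∈ U, ∀ s i, TwiceDifferentiableAt (fun ϑ => pol ϑ s i) θ)
    (hpol₁ : ∃ C : ℝ, ∀ θ ∈ U, ∀ s i j, |jacobian (fun ϑ => pol ϑ s) θ i j| ≤ C)
    (hpol₂ : ∃ C : ℝ, ∀ θ ∈ U, ∀ s i j k, |jacobian₂ (fun ϑ => pol ϑ s) θ i j k| ≤ C)
    {r : ℝ} (hr : 0 < r) (hball : ∀ s, Metric.ball (pol θ₀ s) r ⊆ M.actions)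
    (hQ_diff : ∀ θ ∈ U, ∀ s, ∀ a ∈ Metric.ball (pol θ₀ s) r,
      TwiceDifferentiableAt (M.Q (pol θ) s) a)
    (hQ₁ : ∃ C : ℝ, ∀ θ ∈ U, ∀ s i, |grad (M.Q (pol θ) s) (pol θ s) i| ≤ C)
    (hQ₂ : ∃ C : ℝ, ∀ θ ∈ U, ∀ s, ∀ a ∈ Metric.ball (pol θ₀ s) r, ∀ i j,
      |hess (M.Q (pol θ) s) a i j| ≤ C) :
    ∃ (W : Set (Vec nθ)) (K : ℝ), θ₀ ∈ W ∧ M.RegularOn pol W (pol θ₀) r K := by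
  obtain ⟨C₁, hC₁⟩ := hpol₁
  obtain ⟨C₂, hC₂⟩ := hpol₂
  obtain ⟨C₃, hC₃⟩ := hQ₁
  obtain ⟨C₄, hC₄⟩ := hQ₂
  -- The given bounds may be negative if an index type is empty; absolute values make `K`
  -- nonnegative and at least as large as each of them.
  let K : ℝ := |nθ * (na * C₁)| + |C₂| + |na * C₃| + |na * (na * C₄)|
  have hK₁ : nθ * (na * C₁) ≤ K := by
    linarith [le_abs_self (nθ * (na * C₁)), abs_nonneg C₂, abs_nonneg (na * C₃),
      abs_nonneg (na * (na * C₄))]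
  have hK₂ : C₂ ≤ K := by
    linarith [abs_nonneg (nθ * (na * C₁)), le_abs_self C₂, abs_nonneg (na * C₃),
      abs_nonneg (na * (na * C₄))]
  have hK₃ : na * C₃ ≤ K := by
    linarith [abs_nonneg (nθ * (na * C₁)), abs_nonneg C₂, le_abs_self (na * C₃),
      abs_nonneg (na * (na * C₄))]
  have hK₄ : na * (na * C₄) ≤ K := by
    linarith [abs_nonneg (nθ * (na * C₁)), abs_nonneg C₂, abs_nonneg (na * C₃),
      le_abs_self (na * (na * C₄))]
  have hK : 0 ≤ K := by positivity
  obtain ⟨ε, hε, hεU⟩ := Metric.mem_nhds_iff.mp hU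
  -- The policies are `K`-Lipschitz in the parameter, so this radius moves actions by less than `r /
  -- 2`. Using `K + 1` avoids division by zero.
  let δ := min ε (r / (2 * (K + 1)))
  have hδ : 0 < δ := lt_min hε (by positivity)
  have hWU : Metric.ball θ₀ δ ⊆ U := (Metric.ball_subset_ball (min_le_left _ _)).trans hεU
  have hd : ∀ θ ∈ Metric.ball θ₀ δ, ∀ s, DifferentiableAt ℝ (fun ϑ => pol ϑ s) θ :=
    fun θ hθ s => differentiableAt_euclidean.mpr fun i =>
      (hpol_diff θ (hWU hθ) s i).1.self_of_nhds
  have hd₁ : ∀ θ ∈ Metric.ball θ₀ δ, ∀ s, ‖fderiv ℝ (fun ϑ => pol ϑ s) θ‖ ≤ K :=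
    fun θ hθ s => (norm_fderiv_le_of_jacobian (hd θ hθ s) (hC₁ θ (hWU hθ) s)).trans hK₁
  refine ⟨Metric.ball θ₀ δ, K, Metric.mem_ball_self hδ, ?_⟩
  exact
    { isPolicy := hpol
      isOpen := Metric.isOpen_ball
      convex := convex_ball _ _
      radius_pos := hr
      bound_nonneg := hK
      ball_subset := hball
      mem_ball := fun θ hθ s => by
        have h1 := (convex_ball θ₀ δ).norm_image_sub_le_of_norm_fderiv_le
          (f := fun ϑ => pol ϑ s) (fun x hx => hd x hx s) (fun x hx => hd₁ x hx s)
          (Metric.mem_ball_self hδ) hθ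
        have h2 : ‖θ - θ₀‖ < r / (2 * (K + 1)) := by
          rw [← dist_eq_norm]
          exact (Metric.mem_ball.mp hθ).trans_le (min_le_right _ _)
        rw [Metric.mem_ball, dist_eq_norm]
        calc ‖pol θ s - pol θ₀ s‖ ≤ K * ‖θ - θ₀‖ := h1
          _ ≤ (K + 1) * ‖θ - θ₀‖ := by linarith [norm_nonneg (θ - θ₀)]
          _ < (K + 1) * (r / (2 * (K + 1))) := mul_lt_mul_of_pos_left h2 (by positivity)
          _ = r / 2 := by field_simp
      diff_pol := fun θ hθ s i => (hpol_diff θ (hWU hθ) s i).1.self_of_nhds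
      diff_fderiv_pol := fun θ hθ s i => (hpol_diff θ (hWU hθ) s i).2
      norm_fderiv_pol := hd₁
      abs_jacobian₂ := fun θ hθ s i j k => (hC₂ θ (hWU hθ) s i j k).trans hK₂
      diff_Q := fun θ hθ s a ha => (hQ_diff θ (hWU hθ) s a ha).1.self_of_nhds
      diff_fderiv_Q := fun θ hθ s a ha => (hQ_diff θ (hWU hθ) s a ha).2
      norm_fderiv_Q := fun θ hθ s => (norm_fderiv_le (hC₃ θ (hWU hθ) s)).trans hK₃
      norm_fderiv_fderiv_Q := fun θ hθ s a ha =>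
        (norm_fderiv_fderiv_le (hC₄ θ (hWU hθ) s a ha)).trans hK₄ }

end MDP

end

/-! ### From optimality to the limits of the two matrices -/

theorem mainTheorem1 {S : Type*} [MeasurableSpace S] [MeasurableSingletonClass S] {na nθ : ℕ}
    (M : MDP S na)
    (hγ : M.discount < 1)
    (hR : ∃ B : ℝ, ∀ s, ∀ a ∈ M.actions, |M.reward s a| ≤ B)
    (hp : ∀ s s', ContinuousOn (fun a => M.trans s a s') (interior M.actions))
    -- the parameterized policy, rich enough to contain an optimal policy
    (pol : Vec nθ → S → Vec na) (hpol : ∀ θ, M.IsPolicy (pol θ))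
    (polstar : S → Vec na) (hopt : M.IsOptimal polstar)
    (θstar : Vec nθ) (hrich : ∀ s, pol θstar s = polstar s)
    -- the policy is twice differentiable in the parameters, with bounded derivatives
    (U : Set (Vec nθ)) (hU : U ∈ 𝓝 θstar)
    (hpol_diff : ∀ θ ∈ U, ∀ s i, TwiceDifferentiableAt (fun ϑ => pol ϑ s i) θ)
    (hpol₁ : ∃ C : ℝ, ∀ θ ∈ U, ∀ s i j, |jacobian (fun ϑ => pol ϑ s) θ i j| ≤ C)
    (hpol₂ : ∃ C : ℝ, ∀ θ ∈ U, ∀ s i j k, |jacobian₂ (fun ϑ => pol ϑ s) θ i j k| ≤ C)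
    -- the action-value functions are twice differentiable in the action near the optimal one
    (r : ℝ) (hr : 0 < r) (hball : ∀ s, Metric.ball (polstar s) r ⊆ M.actions)
    (hQ_diff : ∀ θ ∈ U, ∀ s, ∀ a ∈ Metric.ball (polstar s) r,
      TwiceDifferentiableAt (M.Q (pol θ) s) a)
    (hQ₁ : ∃ C : ℝ, ∀ θ ∈ U, ∀ s i, |grad (M.Q (pol θ) s) (pol θ s) i| ≤ C)
    (hQ₂ : ∃ C : ℝ, ∀ θ ∈ U, ∀ s, ∀ a ∈ Metric.ball (polstar s) r, ∀ i j,
      |hess (M.Q (pol θ) s) a i j| ≤ C)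
    (hQ_cont : ∀ s, ContinuousAt (fun x : Vec nθ × Vec na => hess (M.Q (pol x.1) s) x.2)
      (θstar, polstar s)) :
    -- all the quantities in the claim are well defined
    TwiceDifferentiableAt (fun θ => M.J (pol θ)) θstar ∧
    (∀ᶠ θ in 𝓝 θstar, ∀ j k,
      Integrable (fun s => M.integrand₁ pol θ s j k) (M.occupancy (pol θ)) ∧
      Integrable (fun s => M.integrand₂ pol θ s j k) (M.occupancy (pol θ))) ∧
    -- the claim
    Tendsto (M.M₁ pol) (𝓝 θstar) (𝓝 0) ∧
    Tendsto (M.M₂ pol) (𝓝 θstar) (𝓝 (hess (fun θ => M.J (pol θ)) θstar)) ∧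
    M.M₂ pol θstar = hess (fun θ => M.J (pol θ)) θstar := by
  obtain rfl : pol θstar = polstar := funext hrich
  obtain ⟨B, hB⟩ := hR
  obtain ⟨W, K, hW, h⟩ := MDP.exists_regularOn hpol hU hpol_diff hpol₁ hpol₂ hr hball hQ_diff
    hQ₁ hQ₂
  -- The optimal action maximizes `Q` over all admissible actions and is interior, so it is a
  -- critical point.
  have hcrit : ∀ s, fderiv ℝ (M.Q (pol θstar) s) (pol θstar s) = 0 := fun s => by
    refine IsLocalMax.fderiv_eq_zero ?_
    filter_upwards [Metric.ball_mem_nhds (pol θstar s) hr] with a ha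
    exact MDP.IsOptimal.Q_le hγ hB (hpol θstar) hopt s (hball s ha)
  obtain ⟨hJ, hM₂⟩ := h.twiceDifferentiableAt_J_and_M₂_eq hW hcrit hγ hB hp hQ_cont
  refine ⟨hJ, ?_, h.tendsto_M₁ hW hcrit hγ hB,
    hM₂ ▸ h.tendsto_M₂ hW hγ hp hQ_cont, hM₂⟩
  filter_upwards [h.isOpen.eventually_mem hW] with θ hθ j k
  exact ⟨MDP.integrable_occupancy hγ (hpol θ) (h.measurable_integrand₁ hθ j k)
      fun s => h.abs_integrand₁_le hθ s j k (h.norm_fderiv_Q θ hθ s),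
    MDP.integrable_occupancy hγ (hpol θ) (h.measurable_integrand₂ hθ j k)
      fun s => h.abs_integrand₂_le hθ s j k⟩
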